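/- **Definitions.** For a finite simple graph $\mathcal G$ with vertices $v_1,\dots,v_N$, let $CN(\mathcal G)$ be the $N\times N$ matrix whose $(i,j)$ entry is the number of common neighbours of $v_i$ and $v_j$ if $i\neq j$, and $0$ if $i=j$. Let $CNRS(\mathcal G)$ be the diagonal matrix of the row sums of $CN(\mathcal G)$, and put $CNL(\mathcal G)=CNRS(\mathcal G)-CN(\mathcal G)$ and $CNSL(\mathcal G)=CNRS(\mathcal G)+CN(\mathcal G)$. The CNL-spectrum and the CNSL-spectrum of $\mathcal G$ are the multisets of eigenvalues (with multiplicities) of $CNL(\mathcal G)$ and $CNSL(\mathcal G)$; $(\alpha)^a$ means that $\alpha$ is listed $a$ times (the listed values need not be distinct, multiplicities of coinciding values being added, and $a=0$ is allowed). With $\Delta(\mathcal G)=\operatorname{tr}(CNRS(\mathcal G))/N$, the energies $LE_{CN}(\mathcal G)$ and $LE^+_{CN}(\mathcal G)$ are $\sum|\alpha-\Delta(\mathcal G)|$, the sum being over the CNL-spectrum, respectively the CNSL-spectrum, with multiplicities. For a finite non-abelian group $G$, the commuting conjugacy class graph $\Gamma_G$ has as vertices the conjugacy classes of non-central elements of $G$,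 and two distinct classes are adjacent if some element of the one commutes with some element of the other. $K_m$ is the complete graph on $m$ vertices, $\cup$ is disjoint union, and $2K_m=K_m\cup K_m$. $D_{2n}$ is the dihedral group of order $2n$. **Theorem.** Let $G$ be a finite group with $|Z(G)|=z$ and $G/Z(G)\cong D_{2n}$, where $n\ge 3$. (a) If $n$ is even, then $z$ is even, $\Gamma_G\cong K_{(n-1)z/2}\cup 2K_{z/2}$, and (i) the CNL-spectrum of $\Gamma_G$ is $$\left\{(0)^3,\ \left(\tfrac14(nz-z)(nz-z-4)\right)^{\frac12(nz-z-2)},\ \left(\tfrac14z(z-4)\right)^{z-2}\right\},$$ and $$LE_{CN}(\Gamma_G)=\frac{((n-1)z-2)\,\bigl(n(z+1)((n-2)z-4)+11z-4\bigr)}{2(n+1)};$$ (ii) the CNSL-spectrum of $\Gamma_G$ is $$\left\{\left(\tfrac12(nz-z-2)(nz-z-4)\right)^1,\ \left(\tfrac14(nz-z-4)^2\right)^{\frac12(nz-z-2)},\ \left(\tfrac12(z-2)(z-4)\right)^2,\ \left(\tfrac14(z-4)^2\right)^{z-2}\right\},$$ and $$LE^+_{CN}(\Gamma_G)=\begin{cases}\frac{28}{5},&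 n=4,\ z=2,\\[2pt] \frac35z^2(4z-6),& n=4,\ z\ge3,\\[2pt] \frac{(n-2)(n-1)z^2(nz-6)}{2(n+1)},&\text{otherwise.}\end{cases}$$ (b) If $n$ is odd, then $\Gamma_G\cong K_{(n-1)z/2}\cup K_z$, and (i) the CNL-spectrum of $\Gamma_G$ is $$\left\{(0)^2,\ \left(\tfrac14(nz-z)(nz-z-4)\right)^{\frac12(nz-z-2)},\ \left(z(z-2)\right)^{z-1}\right\},$$ and $$LE_{CN}(\Gamma_G)=\begin{cases}0,& n=3,\ z=1,\\[2pt] 4(z-1)(z-2),& n=3,\ z\ge2,\\[2pt] \frac{((n-1)z-2)\left((n-3)(n+1)z^2+((n-6)n+17)z-4(n+1)\right)}{2(n+1)},&\text{otherwise;}\end{cases}$$ (ii) the CNSL-spectrum of $\Gamma_G$ is $$\left\{\left(\tfrac12(nz-z-2)(nz-z-4)\right)^1,\ \left(\tfrac14(nz-z-4)^2\right)^{\frac12(nz-z-2)},\ \left(2(z-1)(z-2)\right)^1,\ \left((z-2)^2\right)^{z-1}\right\},$$ and $$LE^+_{CN}(\Gamma_G)=\begin{cases}0,& n=3,\ z=1\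 \text{ or }\ n=5,\ z=1,\\[2pt] 4(z-1)(z-2),& n=3,\ z\ge2,\\[2pt] \frac{(n-5)(n-3)(n+3)}{2(n+1)},& n\ge7,\ z=1,\\[2pt] \frac{(n-3)(n-1)z^2(nz+z-6)}{2(n+1)},&\text{otherwise.}\end{cases}$$ -/

import Mathlib

/-- The number of common neighbours of each pair of distinct vertices; zero on the diagonal. -/
noncomputable def cnMatrix {V : Type*} [DecidableEq V] (Γ : SimpleGraph V) : Matrix V V ℝ :=
  Matrix.of fun v w => if v = w then 0 else ((Γ.commonNeighbors v w).ncard : ℝ)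

/-- The diagonal matrix of the row sums of `cnMatrix`. -/
noncomputable def cnRowSumMatrix {V : Type*} [Fintype V] [DecidableEq V] (Γ : SimpleGraph V) :
    Matrix V V ℝ :=
  Matrix.diagonal fun v => ∑ w, cnMatrix Γ v w

/-- The common neighborhood Laplacian matrix. -/
noncomputable def cnlMatrix {V : Type*} [Fintype V] [DecidableEq V] (Γ : SimpleGraph V) :
    Matrix V V ℝ :=
  cnRowSumMatrix Γ - cnMatrix Γ

/-- The common neighborhood signless Laplacian matrix. -/
noncomputable def cnslMatrix {V : Type*} [Fintype V] [DecidableEq V] (Γ : SimpleGraph V) :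
    Matrix V V ℝ :=
  cnRowSumMatrix Γ + cnMatrix Γ

/-- The eigenvalues of the common neighborhood Laplacian matrix, with multiplicities. The matrix
is real symmetric, so its characteristic polynomial has all its roots in `ℝ`. -/
noncomputable def cnlSpec {V : Type*} [Fintype V] [DecidableEq V] (Γ : SimpleGraph V) :
    Multiset ℝ :=
  (cnlMatrix Γ).charpoly.roots

/-- The eigenvalues of the common neighborhood signless Laplacian matrix, with multiplicities. -/
noncomputable def cnslSpec {V : Type*} [Fintype V] [DecidableEq V] (Γ : SimpleGraph V) :
    Multiset ℝ :=
  (cnslMatrix Γ).charpoly.roots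

/-- The trace of the row-sum matrix divided by the number of vertices. -/
noncomputable def cnDelta {V : Type*} [Fintype V] [DecidableEq V] (Γ : SimpleGraph V) : ℝ :=
  (cnRowSumMatrix Γ).trace / (Fintype.card V : ℝ)

/-- The common neighborhood Laplacian energy. -/
noncomputable def cnlEnergy {V : Type*} [Fintype V] [DecidableEq V] (Γ : SimpleGraph V) : ℝ :=
  ((cnlSpec Γ).map fun α => |α - cnDelta Γ|).sum

/-- The common neighborhood signless Laplacian energy. -/
noncomputable def cnslEnergy {V : Type*} [Fintype V] [DecidableEq V] (Γ : SimpleGraph V) : ℝ :=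
  ((cnslSpec Γ).map fun β => |β - cnDelta Γ|).sum

/-- The conjugacy classes of the non-central elements of `G`. -/
def CCCVertex (G : Type*) [Group G] : Type _ :=
  {c : ConjClasses G // ∃ x : G, x ∉ Subgroup.center G ∧ ConjClasses.mk x = c}

noncomputable instance CCCVertex.instFintype (G : Type*) [Group G] [Finite G] :
    Fintype (CCCVertex G) :=
  haveI : Finite (ConjClasses G) := Quotient.finite _
  haveI : Finite (CCCVertex G) := Subtype.finite
  Fintype.ofFinite _

noncomputable instance CCCVertex.instDecidableEq (G : Type*) [Group G] :
    DecidableEq (CCCVertex G) :=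
  Classical.decEq _

/-- The commuting conjugacy class graph: distinct non-central classes are adjacent when they
contain commuting representatives. -/
def cccGraph (G : Type*) [Group G] : SimpleGraph (CCCVertex G) where
  Adj c d := c ≠ d ∧ ∃ x ∈ c.1.carrier, ∃ y ∈ d.1.carrier, Commute x y
  symm := ⟨fun _ _ h => ⟨h.1.symm, by
    obtain ⟨x, hx, y, hy, hxy⟩ := h.2
    exact ⟨y, hy, x, hx, hxy.symm⟩⟩⟩
  loopless := ⟨fun _ h => h.1 rfl⟩

/-! Fix a surjection `φ` from G onto the dihedral group with kernel Z(G). The preimage of the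
rotations is generated by one element together with the center, so it is abelian; an element over a
reflection commutes, apart from central elements, only with its own coset of Z(G). Hence a
non-central class over rotations has 2 elements and a class over reflections has n.

Classes over rotations are pairwise adjacent. Two classes over reflections are adjacent exactly when
their images are conjugate, since a conjugator can be lifted through `φ` to make the images equal.
So the graph is a disjoint union of cliques indexed by a `kind`: rotation, or the parity of the
reflection's index. Dividing numbers of elements by class sizes gives (n-1)z/2 rotation classes and
z reflection classes. The latter split evenly for even n, while for odd n only one kind of
reflection exists.

On K_m the common neighbourhood matrix is (m-2)(J-I), with J the all-ones matrix, so CNL and CNSL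
are combinations of I and J. Disjoint unions give block diagonal matrices, and the spectra follow.
There are (n+1)z/2 vertices, which accounts for the denominators n+1. Each energy then depends only
on which eigenvalues exceed the mean Δ; the exceptional branches are small parameters where a sign
changes or the general formula merely specializes. -/

open Polynomial in
/-- The characteristic polynomial of the matrix with diagonal entries `a + b` and off-diagonal
entries `b`. -/
theorem Matrix.charpoly_scalar_add_const {ι R : Type*} [Fintype ι] [DecidableEq ι] [Nonempty ι]
    [CommRing R] (a b : R) :
    (Matrix.scalar ι a + Matrix.of fun _ _ : ι => b).charpoly =
      (X - C (a + Fintype.card ι * b)) * (X - C a) ^ (Fintype.card ι - 1) := by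
  have h : Matrix.scalar ι a + Matrix.of (fun _ _ : ι => b) =
      Matrix.vecMulVec (fun _ => b) (fun _ => 1) - Matrix.scalar ι (-a) := by
    ext i j
    simp [Matrix.vecMulVec, add_comm, Matrix.diagonal_apply, sub_eq_add_neg]
    split_ifs <;> simp
  obtain ⟨k, hk⟩ : ∃ k, Fintype.card ι = k + 1 :=
    Nat.exists_eq_succ_of_ne_zero Fintype.card_ne_zero
  rw [h, Matrix.charpoly_sub_scalar, Matrix.charpoly_vecMulVec]
  simp [dotProduct, hk, smul_eq_C_mul, pow_succ]
  ring

/-! ### Invariance under graph isomorphism -/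

section Iso

variable {V W : Type*} [DecidableEq V] [DecidableEq W] {Γ : SimpleGraph V} {Δ : SimpleGraph W}

theorem cnMatrix_iso (e : Γ ≃g Δ) (v w : V) : cnMatrix Δ (e v) (e w) = cnMatrix Γ v w := by
  have h : Δ.commonNeighbors (e v) (e w) = Set.image e (Γ.commonNeighbors v w) := by
    ext x
    obtain ⟨x, rfl⟩ := e.surjective x
    simp [SimpleGraph.commonNeighbors, e.map_adj_iff]
  simp [cnMatrix, h, Set.ncard_image_of_injective _ e.injective]

theorem cnMatrix_reindex (e : Γ ≃g Δ) :
    Matrix.reindex e.toEquiv e.toEquiv (cnMatrix Γ) = cnMatrix Δ := by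
  ext v w
  obtain ⟨v, rfl⟩ := e.surjective v
  obtain ⟨w, rfl⟩ := e.surjective w
  have hs : ∀ u, e.toEquiv.symm (e u) = u := e.toEquiv.symm_apply_apply
  simp [cnMatrix_iso, hs]

variable [Fintype V] [Fintype W]

theorem cnRowSumMatrix_reindex (e : Γ ≃g Δ) :
    Matrix.reindex e.toEquiv e.toEquiv (cnRowSumMatrix Γ) = cnRowSumMatrix Δ := by
  ext v w
  obtain ⟨v, rfl⟩ := e.surjective v
  obtain ⟨w, rfl⟩ := e.surjective w
  have h : ∑ u, cnMatrix Δ (e v) u = ∑ u, cnMatrix Γ v u :=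
    (Fintype.sum_equiv e.toEquiv _ _ fun u => (cnMatrix_iso e v u).symm).symm
  have hs : ∀ u, e.toEquiv.symm (e u) = u := e.toEquiv.symm_apply_apply
  simp [cnRowSumMatrix, Matrix.diagonal_apply, h, hs]

theorem cnlSpec_congr (e : Γ ≃g Δ) : cnlSpec Γ = cnlSpec Δ := by
  have h : Matrix.reindex e.toEquiv e.toEquiv (cnlMatrix Γ) = cnlMatrix Δ := by
    rw [cnlMatrix, cnlMatrix, ← cnRowSumMatrix_reindex e, ← cnMatrix_reindex e]
    rfl
  rw [cnlSpec, cnlSpec, ← h, Matrix.charpoly_reindex]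

theorem cnslSpec_congr (e : Γ ≃g Δ) : cnslSpec Γ = cnslSpec Δ := by
  have h : Matrix.reindex e.toEquiv e.toEquiv (cnslMatrix Γ) = cnslMatrix Δ := by
    rw [cnslMatrix, cnslMatrix, ← cnRowSumMatrix_reindex e, ← cnMatrix_reindex e]
    rfl
  rw [cnslSpec, cnslSpec, ← h, Matrix.charpoly_reindex]

theorem cnDelta_congr (e : Γ ≃g Δ) : cnDelta Γ = cnDelta Δ := by
  rw [cnDelta, cnDelta, ← cnRowSumMatrix_reindex e, Fintype.card_congr e.toEquiv]
  congr 1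
  exact (Fintype.sum_equiv e.toEquiv.symm _ _ fun _ => rfl).symm

end Iso

/-! ### Disjoint unions: block diagonal matrices -/

section Sum

variable {V W : Type*} [DecidableEq V] [DecidableEq W] (Γ : SimpleGraph V) (Δ : SimpleGraph W)

theorem cnMatrix_sum : cnMatrix (Γ ⊕g Δ) = Matrix.fromBlocks (cnMatrix Γ) 0 0 (cnMatrix Δ) := by
  ext (v | v) (w | w)
  · have h : (Γ ⊕g Δ).commonNeighbors (.inl v) (.inl w) = Set.image Sum.inl (Γ.commonNeighbors v w) := by
      ext (x | x) <;> simp [SimpleGraph.commonNeighbors]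
    simp [cnMatrix, h, Set.ncard_image_of_injective _ Sum.inl_injective]
  · have h : (Γ ⊕g Δ).commonNeighbors (.inl v) (.inr w) = ∅ := by
      ext (x | x) <;> simp [SimpleGraph.commonNeighbors]
    simp [cnMatrix, h]
  · have h : (Γ ⊕g Δ).commonNeighbors (.inr v) (.inl w) = ∅ := by
      ext (x | x) <;> simp [SimpleGraph.commonNeighbors]
    simp [cnMatrix, h]
  · have h : (Γ ⊕g Δ).commonNeighbors (.inr v) (.inr w) = Set.image Sum.inr (Δ.commonNeighbors v w) := by
      ext (x | x) <;> simp [SimpleGraph.commonNeighbors]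
    simp [cnMatrix, h, Set.ncard_image_of_injective _ Sum.inr_injective]

variable [Fintype V] [Fintype W]

theorem cnRowSumMatrix_sum :
    cnRowSumMatrix (Γ ⊕g Δ) =
      Matrix.fromBlocks (cnRowSumMatrix Γ) 0 0 (cnRowSumMatrix Δ) := by
  rw [cnRowSumMatrix, cnRowSumMatrix, cnRowSumMatrix, Matrix.fromBlocks_diagonal, cnMatrix_sum]
  congr 1
  ext (v | v) <;> simp

theorem cnlSpec_sum : cnlSpec (Γ ⊕g Δ) = cnlSpec Γ + cnlSpec Δ := by
  have h : cnlMatrix (Γ ⊕g Δ) = Matrix.fromBlocks (cnlMatrix Γ) 0 0 (cnlMatrix Δ) := by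
    rw [cnlMatrix, cnRowSumMatrix_sum, cnMatrix_sum, sub_eq_add_neg, Matrix.fromBlocks_neg,
      Matrix.fromBlocks_add]
    simp [cnlMatrix, sub_eq_add_neg]
  rw [cnlSpec, h, Matrix.charpoly_fromBlocks_zero₁₂, Polynomial.roots_mul, cnlSpec, cnlSpec]
  exact mul_ne_zero (Matrix.charpoly_monic _).ne_zero (Matrix.charpoly_monic _).ne_zero

theorem cnslSpec_sum : cnslSpec (Γ ⊕g Δ) = cnslSpec Γ + cnslSpec Δ := by
  have h : cnslMatrix (Γ ⊕g Δ) = Matrix.fromBlocks (cnslMatrix Γ) 0 0 (cnslMatrix Δ) := by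
    rw [cnslMatrix, cnRowSumMatrix_sum, cnMatrix_sum, Matrix.fromBlocks_add]
    simp [cnslMatrix]
  rw [cnslSpec, h, Matrix.charpoly_fromBlocks_zero₁₂, Polynomial.roots_mul, cnslSpec, cnslSpec]
  exact mul_ne_zero (Matrix.charpoly_monic _).ne_zero (Matrix.charpoly_monic _).ne_zero

theorem trace_cnRowSumMatrix_sum :
    (cnRowSumMatrix (Γ ⊕g Δ)).trace = (cnRowSumMatrix Γ).trace + (cnRowSumMatrix Δ).trace := by
  rw [cnRowSumMatrix_sum, Matrix.trace, Fintype.sum_sum_type]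
  rfl

end Sum

/-! ### Spectra of complete graphs -/

section Complete

variable (m : ℕ)

theorem cnMatrix_completeGraph (v w : Fin m) :
    cnMatrix (SimpleGraph.completeGraph (Fin m)) v w = if v = w then 0 else (m : ℝ) - 2 := by
  rw [cnMatrix, Matrix.of_apply]
  split_ifs with h
  · rfl
  -- Two distinct vertices force m ≥ 2, so the natural number m - 2 casts to the real one.
  · have h2 : 2 ≤ m := by
      simpa [Finset.card_pair h] using Finset.card_le_univ ({v, w} : Finset (Fin m))
    rw [SimpleGraph.completeGraph_eq_top, SimpleGraph.commonNeighbors_top_eq,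
      Set.ncard_sdiff (Set.subset_univ _), Set.ncard_univ, Set.ncard_pair h, Nat.card_fin,
      Nat.cast_sub h2, Nat.cast_ofNat]

theorem sum_cnMatrix_completeGraph (v : Fin m) :
    ∑ w, cnMatrix (SimpleGraph.completeGraph (Fin m)) v w = ((m : ℝ) - 1) * (m - 2) := by
  have h1 : 1 ≤ m := v.pos
  simp [cnMatrix_completeGraph, Finset.sum_ite, Finset.filter_ne, Finset.card_erase_of_mem, h1]
  ring

theorem trace_cnRowSumMatrix_completeGraph :
    (cnRowSumMatrix (SimpleGraph.completeGraph (Fin m))).trace =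
      (m : ℝ) * ((m - 1) * (m - 2)) := by
  simp [cnRowSumMatrix, Matrix.trace, sum_cnMatrix_completeGraph]

variable {m}

/-- The matrix is m(m-2)I - (m-2)J, and J has eigenvalue m once and 0 otherwise. The formula
persists at m = 1, where only the eigenvalue 0 is left. -/
theorem cnlSpec_completeGraph (hm : 1 ≤ m) :
    cnlSpec (SimpleGraph.completeGraph (Fin m)) =
      Multiset.replicate 1 0 + Multiset.replicate (m - 1) ((m : ℝ) * (m - 2)) := by
  have : Nonempty (Fin m) := ⟨⟨0, hm⟩⟩
  have h : cnlMatrix (SimpleGraph.completeGraph (Fin m)) =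
      Matrix.scalar (Fin m) ((m : ℝ) * (m - 2)) + Matrix.of fun _ _ => -((m : ℝ) - 2) := by
    ext v w
    rw [cnlMatrix, Matrix.sub_apply, cnRowSumMatrix, Matrix.diagonal_apply,
      sum_cnMatrix_completeGraph, cnMatrix_completeGraph, Matrix.add_apply, Matrix.scalar_apply,
      Matrix.diagonal_apply, Matrix.of_apply]
    split_ifs <;> ring
  rw [cnlSpec, h, Matrix.charpoly_scalar_add_const, Polynomial.roots_mul, Polynomial.roots_pow,
    Polynomial.roots_X_sub_C, Polynomial.roots_X_sub_C, Fintype.card_fin,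
    Multiset.nsmul_singleton, Multiset.replicate_one]
  · congr 2
    ring
  · exact mul_ne_zero (Polynomial.X_sub_C_ne_zero _) (pow_ne_zero _ (Polynomial.X_sub_C_ne_zero _))

/-- The matrix is (m-2)²I + (m-2)J. -/
theorem cnslSpec_completeGraph (hm : 1 ≤ m) :
    cnslSpec (SimpleGraph.completeGraph (Fin m)) =
      Multiset.replicate 1 (2 * ((m : ℝ) - 1) * (m - 2)) +
        Multiset.replicate (m - 1) (((m : ℝ) - 2) ^ 2) := by
  have : Nonempty (Fin m) := ⟨⟨0, hm⟩⟩
  have h : cnslMatrix (SimpleGraph.completeGraph (Fin m)) =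
      Matrix.scalar (Fin m) (((m : ℝ) - 2) ^ 2) + Matrix.of fun _ _ => (m : ℝ) - 2 := by
    ext v w
    rw [cnslMatrix, Matrix.add_apply, cnRowSumMatrix, Matrix.diagonal_apply,
      sum_cnMatrix_completeGraph, cnMatrix_completeGraph, Matrix.add_apply, Matrix.scalar_apply,
      Matrix.diagonal_apply, Matrix.of_apply]
    split_ifs <;> ring
  rw [cnslSpec, h, Matrix.charpoly_scalar_add_const, Polynomial.roots_mul, Polynomial.roots_pow,
    Polynomial.roots_X_sub_C, Polynomial.roots_X_sub_C, Fintype.card_fin,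
    Multiset.nsmul_singleton, Multiset.replicate_one]
  · congr 2
    ring
  · exact mul_ne_zero (Polynomial.X_sub_C_ne_zero _) (pow_ne_zero _ (Polynomial.X_sub_C_ne_zero _))

end Complete

/-! ### Reflections in dihedral groups and the parity of their index -/

namespace DihedralGroup

variable {n : ℕ}

open Classical in
/-- The kind of an element of a dihedral group: `0` for rotations, `1` and `2` for the reflections
`sr i` with `i` even, respectively not even, in `ZMod n`. -/
noncomputable def kind : DihedralGroup n → Fin 3
  | r _ => 0
  | sr i => if Even i then 1 else 2

@[simp]
theorem kind_r (i : ZMod n) : kind (r i) = 0 := rfl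

open Classical in
theorem kind_sr (i : ZMod n) : kind (sr i) = if Even i then 1 else 2 := rfl

theorem kind_sr_ne_zero (i : ZMod n) : kind (sr i) ≠ 0 := by
  rw [kind_sr]
  split_ifs <;> decide

theorem kind_eq_zero_iff {d : DihedralGroup n} : kind d = 0 ↔ ∃ i, d = r i := by
  cases d with
  | r i => simp
  | sr i => simp [kind_sr_ne_zero]

theorem kind_ne_zero_iff {d : DihedralGroup n} : kind d ≠ 0 ↔ ∃ i, d = sr i := by
  cases d with
  | r i => simp
  | sr i => simp [kind_sr_ne_zero]

theorem even_or_exists_eq_add_one [NeZero n] (i : ZMod n) : Even i ∨ ∃ k, i = k + k + 1 := by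
  rcases Nat.even_or_odd i.val with ⟨k, hk⟩ | ⟨k, hk⟩
  · left
    exact ⟨k, by rw [← ZMod.natCast_zmod_val i, hk, Nat.cast_add]⟩
  · right
    exact ⟨k, by rw [← ZMod.natCast_zmod_val i, hk]; push_cast; ring⟩

theorem not_even_add_one_of_even (hn : Even n) {i : ZMod n} (hi : Even i) : ¬ Even (i + 1) := by
  rintro ⟨l, hl⟩
  obtain ⟨k, rfl⟩ := hi
  -- Parity is well defined on `ZMod n` because 2 divides n: reduce modulo 2.
  have h := congrArg (ZMod.castHom hn.two_dvd (ZMod 2)) hl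
  simp only [map_add, map_one, CharTwo.add_self_eq_zero] at h
  revert h
  decide

theorem even_of_odd (hn : Odd n) (i : ZMod n) : Even i := by
  have : NeZero n := ⟨hn.pos.ne'⟩
  rcases even_or_exists_eq_add_one i with h | ⟨k, rfl⟩
  · exact h
  · obtain ⟨m, hm⟩ := hn
    -- Twice this is (2k + 1) + (2m + 1), and 2m + 1 = n vanishes.
    refine ⟨k + m + 1, ?_⟩
    have h0 : ((2 * m + 1 : ℕ) : ZMod n) = 0 := by rw [← hm]; exact ZMod.natCast_self n
    push_cast at h0
    linear_combination -h0

theorem kind_ne_two_of_odd (hn : Odd n) (d : DihedralGroup n) : kind d ≠ 2 := by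
  cases d with
  | r i => simp
  | sr i => simp [kind_sr, even_of_odd hn i]

/-- Conjugation maps rotations to rotations and changes the index of a reflection by an even
element. -/
theorem kind_eq_of_isConj {d e : DihedralGroup n} (h : IsConj d e) : kind d = kind e := by
  obtain ⟨c, rfl⟩ := isConj_iff.1 h
  have key : ∀ i j k : ZMod n, j = i + (k + k) → kind (sr i) = kind (sr j) := by
    rintro i j k rfl
    have : Even (i + (k + k)) ↔ Even i :=
      ⟨fun h => by simpa using h.sub ⟨k, rfl⟩, fun h => h.add ⟨k, rfl⟩⟩
    classical exact (if_congr this rfl rfl).symm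
  cases d with
  | r i => cases c <;> simp
  | sr i =>
    cases c with
    | r j =>
      simp only [r_mul_sr, inv_r, sr_mul_r]
      exact key _ _ (-j) (by ring)
    | sr j =>
      simp only [sr_mul_sr, inv_sr, r_mul_sr]
      exact key _ _ (j - i) (by ring)

/-- Indices of equal parity differ by some k + k, and conjugation by `r (-k)` adds exactly that. -/
theorem isConj_of_kind_eq [NeZero n] {d e : DihedralGroup n} (hd : kind d ≠ 0)
    (h : kind d = kind e) : IsConj d e := by
  obtain ⟨i, rfl⟩ := kind_ne_zero_iff.1 hd
  obtain ⟨j, rfl⟩ := kind_ne_zero_iff.1 (h ▸ hd)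
  have key : ∃ k, j = i + (k + k) := by
    by_cases hi : Even i <;> by_cases hj : Even j
    · obtain ⟨a, rfl⟩ := hi
      obtain ⟨b, rfl⟩ := hj
      exact ⟨b - a, by ring⟩
    · simp [kind_sr, hi, hj] at h
    · simp [kind_sr, hi, hj] at h
    · obtain ⟨a, rfl⟩ := (even_or_exists_eq_add_one i).resolve_left hi
      obtain ⟨b, rfl⟩ := (even_or_exists_eq_add_one j).resolve_left hj
      exact ⟨b - a, by ring⟩
  obtain ⟨k, rfl⟩ := key
  refine isConj_iff.2 ⟨r (-k), ?_⟩
  simp only [r_mul_sr, inv_r, sr_mul_r]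
  congr 1
  ring

theorem kind_mul_r_one_eq_two_iff [NeZero n] (hn : Even n) (d : DihedralGroup n) :
    kind (d * r 1) = 2 ↔ kind d = 1 := by
  cases d with
  | r i => simp
  | sr i =>
    rcases even_or_exists_eq_add_one i with h | ⟨k, rfl⟩
    · simp [kind_sr, h, not_even_add_one_of_even hn h]
    · have h1 : ¬ Even (k + k + 1) := not_even_add_one_of_even hn ⟨k, rfl⟩
      have h2 : Even (k + k + 1 + 1) := ⟨k + 1, by ring⟩
      simp [kind_sr, h1, h2]

theorem mem_zpowers_r_one_iff [NeZero n] {d : DihedralGroup n} :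
    d ∈ Subgroup.zpowers (r 1 : DihedralGroup n) ↔ kind d = 0 := by
  rw [kind_eq_zero_iff, Subgroup.mem_zpowers_iff]
  constructor
  · rintro ⟨k, rfl⟩
    exact ⟨k, r_one_zpow k⟩
  · rintro ⟨i, rfl⟩
    exact ⟨i.val, by simp⟩

theorem index_zpowers_r_one [NeZero n] :
    (Subgroup.zpowers (r 1 : DihedralGroup n)).index = 2 := by
  have h := (Subgroup.zpowers (r 1 : DihedralGroup n)).index_mul_card
  rw [Nat.card_zpowers, orderOf_r_one, nat_card] at h
  exact Nat.eq_of_mul_eq_mul_right (NeZero.pos n) h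

theorem index_zpowers_sr [NeZero n] (i : ZMod n) :
    (Subgroup.zpowers (sr i : DihedralGroup n)).index = n := by
  have h := (Subgroup.zpowers (sr i : DihedralGroup n)).index_mul_card
  rw [Nat.card_zpowers, orderOf_sr, nat_card] at h
  omega

theorem mem_zpowers_sr_iff (i : ZMod n) {d : DihedralGroup n} :
    d ∈ Subgroup.zpowers (sr i : DihedralGroup n) ↔ d = 1 ∨ d = sr i := by
  constructor
  · rintro ⟨k, rfl⟩
    rcases Int.even_or_odd' k with ⟨l, rfl | rfl⟩
    · left; simp [zpow_mul, pow_two]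
    · right; simp [zpow_add, zpow_mul, pow_two]
  · rintro (rfl | rfl)
    · exact one_mem _
    · exact Subgroup.mem_zpowers _

end DihedralGroup

/-! ### Commutation and centralizers in a group that is dihedral modulo its center -/

section CentralDihedral

open DihedralGroup

variable {G : Type*} [Group G] {n : ℕ} [NeZero n] {φ : G →* DihedralGroup n}

/-- If `a` lifts `r 1`, every element over a rotation is a power of `a` times a central element. -/
theorem commute_of_kind_eq_zero (hφ : Function.Surjective φ)
    (hker : ∀ g, φ g = 1 ↔ g ∈ Subgroup.center G) {x y : G} (hx : kind (φ x) = 0)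
    (hy : kind (φ y) = 0) : Commute x y := by
  obtain ⟨a, ha⟩ := hφ (r 1)
  have key : ∀ g, kind (φ g) = 0 → ∃ (k : ℤ), ∃ c ∈ Subgroup.center G, g = a ^ k * c := by
    intro g hg
    obtain ⟨k, hk⟩ := mem_zpowers_r_one_iff.2 hg
    refine ⟨k, (a ^ k)⁻¹ * g, (hker _).1 ?_, by group⟩
    rw [map_mul, map_inv, map_zpow, ha, ← hk]
    simp
  obtain ⟨k, c, hc, rfl⟩ := key x hx
  obtain ⟨l, d, hd, rfl⟩ := key y hy
  have hc' : ∀ g, Commute c g := fun g => (Subgroup.mem_center_iff.1 hc g).symm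
  have hd' : ∀ g, Commute g d := fun g => Subgroup.mem_center_iff.1 hd g
  exact ((((Commute.refl a).zpow_zpow k l).mul_right (hd' _)).mul_left (hc' _))

/-- The abelian preimage of the rotations and any one element over a reflection generate G, so
commuting with both means being central. -/
theorem map_eq_one_of_commute (hφ : Function.Surjective φ)
    (hker : ∀ g, φ g = 1 ↔ g ∈ Subgroup.center G) {x y : G} (hx : kind (φ x) = 0)
    (hy : kind (φ y) ≠ 0) (h : Commute x y) : φ x = 1 := by
  rw [hker, Subgroup.mem_center_iff]
  intro g
  change Commute g x
  by_cases hg : kind (φ g) = 0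
  · exact commute_of_kind_eq_zero hφ hker hg hx
  · obtain ⟨i, hi⟩ := kind_ne_zero_iff.1 hg
    obtain ⟨j, hj⟩ := kind_ne_zero_iff.1 hy
    have h1 : Commute (g * y⁻¹) x :=
      commute_of_kind_eq_zero hφ hker (by simp [hi, hj]) hx
    simpa using h1.mul_left h.symm

/-- Two non-central elements commute if and only if both are rotations modulo the center, or they
agree modulo the center. -/
theorem commute_iff_of_map_ne_one (hφ : Function.Surjective φ)
    (hker : ∀ g, φ g = 1 ↔ g ∈ Subgroup.center G) {x y : G} (hx : φ x ≠ 1) (hy : φ y ≠ 1) :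
    Commute x y ↔ (kind (φ x) = 0 ∧ kind (φ y) = 0) ∨ φ x = φ y := by
  constructor
  · intro h
    by_cases h1 : kind (φ x) = 0 <;> by_cases h2 : kind (φ y) = 0
    · exact .inl ⟨h1, h2⟩
    · exact absurd (map_eq_one_of_commute hφ hker h1 h2 h) hx
    · exact absurd (map_eq_one_of_commute hφ hker h2 h1 h.symm) hy
    · right
      obtain ⟨i, hi⟩ := kind_ne_zero_iff.1 h1
      obtain ⟨j, hj⟩ := kind_ne_zero_iff.1 h2
      -- The quotient of two reflections is a rotation, and `x * y⁻¹` commutes with `y`, so it is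
      -- central.
      have h3 : φ (x * y⁻¹) = 1 :=
        map_eq_one_of_commute hφ hker (by simp [hi, hj]) h2
          (h.mul_left (Commute.refl y).inv_left)
      rwa [map_mul, map_inv, mul_inv_eq_one] at h3
  · rintro (⟨h1, h2⟩ | h)
    · exact commute_of_kind_eq_zero hφ hker h1 h2
    · have h3 : x * y⁻¹ ∈ Subgroup.center G := by simp [← hker, h]
      have h4 : Commute (x * y⁻¹) y := (Subgroup.mem_center_iff.1 h3 y).symm
      simpa using h4.mul_left (Commute.refl y)

theorem centralizer_of_kind_eq_zero (hφ : Function.Surjective φ)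
    (hker : ∀ g, φ g = 1 ↔ g ∈ Subgroup.center G) {x : G} (hx : φ x ≠ 1)
    (h0 : kind (φ x) = 0) :
    Subgroup.centralizer {x} = (Subgroup.zpowers (r 1 : DihedralGroup n)).comap φ := by
  ext g
  rw [Subgroup.mem_centralizer_singleton_iff, Subgroup.mem_comap, mem_zpowers_r_one_iff]
  constructor
  · intro h
    by_contra hg
    exact hx (map_eq_one_of_commute hφ hker h0 hg (Commute.symm h))
  · exact fun h => commute_of_kind_eq_zero hφ hker h h0

/-- By the commutation criterion only the center and the coset of `x` commute with `x`; these are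
the preimage of a subgroup of order 2, hence of index n. -/
theorem centralizer_of_kind_ne_zero (hφ : Function.Surjective φ)
    (hker : ∀ g, φ g = 1 ↔ g ∈ Subgroup.center G) {x : G} (h0 : kind (φ x) ≠ 0) :
    Subgroup.centralizer {x} = (Subgroup.zpowers (φ x)).comap φ := by
  have hx : φ x ≠ 1 := by
    rintro h
    exact h0 (by rw [h, one_def, kind_r])
  obtain ⟨i, hi⟩ := kind_ne_zero_iff.1 h0
  ext g
  rw [Subgroup.mem_centralizer_singleton_iff, Subgroup.mem_comap, hi, mem_zpowers_sr_iff, ← hi]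
  change Commute g x ↔ _
  by_cases hg : φ g = 1
  · simp only [hg, true_or, iff_true]
    exact (Subgroup.mem_center_iff.1 ((hker g).1 hg) x).symm
  · rw [commute_iff_of_map_ne_one hφ hker hg hx]
    simp [hg, h0]

/-- Orbit-stabilizer for the conjugation action. -/
theorem ncard_carrier_mk (x : G) :
    (ConjClasses.mk x).carrier.ncard = (Subgroup.centralizer {x}).index := by
  rw [← ConjAct.orbit_eq_carrier_conjClasses, ← MulAction.index_stabilizer,
    Subgroup.centralizer_eq_comap_stabilizer]
  exact (Subgroup.index_comap_of_surjective _ ConjAct.toConjAct.surjective).symm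

theorem ncard_carrier_mk_of_kind_eq_zero (hφ : Function.Surjective φ)
    (hker : ∀ g, φ g = 1 ↔ g ∈ Subgroup.center G) {x : G} (hx : φ x ≠ 1)
    (h0 : kind (φ x) = 0) : (ConjClasses.mk x).carrier.ncard = 2 := by
  rw [ncard_carrier_mk, centralizer_of_kind_eq_zero hφ hker hx h0,
    Subgroup.index_comap_of_surjective _ hφ, index_zpowers_r_one]

theorem ncard_carrier_mk_of_kind_ne_zero (hφ : Function.Surjective φ)
    (hker : ∀ g, φ g = 1 ↔ g ∈ Subgroup.center G) {x : G} (h0 : kind (φ x) ≠ 0) :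
    (ConjClasses.mk x).carrier.ncard = n := by
  obtain ⟨i, hi⟩ := kind_ne_zero_iff.1 h0
  rw [ncard_carrier_mk, centralizer_of_kind_ne_zero hφ hker h0,
    Subgroup.index_comap_of_surjective _ hφ, hi, index_zpowers_sr]

end CentralDihedral

/-! ### Graphs that are unions of at most three cliques -/

section Graph

/-- A graph in which the vertices satisfying `p` are pairwise adjacent, and not adjacent to any
other vertex, splits off a complete graph. -/
theorem SimpleGraph.nonempty_iso_completeGraph_sum {V W : Type*} [Finite V] {Γ : SimpleGraph V}
    {Δ : SimpleGraph W} (p : V → Prop) {a : ℕ} (ha : Nat.card {v // p v} = a)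
    (hp : ∀ v w, p v → (Γ.Adj v w ↔ v ≠ w ∧ p w))
    (e : Γ.induce {v | ¬ p v} ≃g Δ) :
    Nonempty (Γ ≃g completeGraph (Fin a) ⊕g Δ) := by
  classical
  let f : {v // p v} ≃ Fin a := Finite.equivFinOfCardEq ha
  let E : V ≃ Fin a ⊕ W := (Equiv.sumCompl p).symm.trans (Equiv.sumCongr f e.toEquiv)
  have hl : ∀ (v : V) (h : p v), E v = .inl (f ⟨v, h⟩) := fun v h => by
    simp [E, Equiv.sumCompl_symm_apply_of_pos h]
  have hr : ∀ (v : V) (h : ¬ p v), E v = .inr (e ⟨v, h⟩) := fun v h => by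
    simp [E, Equiv.sumCompl_symm_apply_of_neg h]
  refine ⟨E, ?_⟩
  intro v w
  by_cases hv : p v <;> by_cases hw : p w
  · rw [hl v hv, hl w hw, hp v w hv]
    simp [hw]
  · rw [hl v hv, hr w hw, hp v w hv]
    simp [hw]
  · rw [hr v hv, hl w hw, Γ.adj_comm, hp w v hw]
    simp [hv]
  · rw [hr v hv, hr w hw, sum_adj_inr, e.map_adj_iff]
    rfl

/-- A graph whose distinct vertices are adjacent exactly when they have the same kind is a disjoint
union of complete graphs. -/
theorem SimpleGraph.nonempty_iso_completeGraph_sum_sum {V : Type*} [Finite V] {Γ : SimpleGraph V}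
    (κ : V → Fin 3) (h : ∀ v w, Γ.Adj v w ↔ v ≠ w ∧ κ v = κ w) {a b c : ℕ}
    (ha : Nat.card {v // κ v = 0} = a) (hb : Nat.card {v // κ v = 1} = b)
    (hc : Nat.card {v // κ v = 2} = c) :
    Nonempty (Γ ≃g completeGraph (Fin a) ⊕g (completeGraph (Fin b) ⊕g completeGraph (Fin c))) := by
  -- Peel off the cliques of kinds 0 and 1 in turn; what remains has kind 2 and is itself a clique.
  let Γ₁ := Γ.induce {v | ¬ κ v = 0}
  let Γ₂ := Γ₁.induce {v | ¬ κ v.1 = 1}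
  have three : ∀ i : Fin 3, i ≠ 0 → i ≠ 1 → i = 2 := by decide
  have hb' : Nat.card {v : ({v | ¬ κ v = 0} : Set V) // κ v.1 = 1} = b := by
    rw [← hb]
    refine Nat.card_congr ⟨fun v => ⟨v.1.1, v.2⟩, fun v => ⟨⟨v.1, by simp [v.2]⟩, v.2⟩, ?_, ?_⟩
    · intro v; rfl
    · intro v; rfl
  have hc' : Nat.card ({v | ¬ κ v.1 = 1} : Set ({v | ¬ κ v = 0} : Set V)) = c := by
    rw [← hc]
    refine Nat.card_congr ⟨fun v => ⟨v.1.1, three _ v.1.2 v.2⟩,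
      fun v => ⟨⟨v.1, by simp [v.2]⟩, by simp [v.2]⟩, ?_, ?_⟩
    · intro v; rfl
    · intro v; rfl
  have e₂ : Γ₂ ≃g completeGraph (Fin c) :=
    { toEquiv := Finite.equivFinOfCardEq hc'
      map_rel_iff' := by
        intro v w
        have hvw : κ v.1.1 = κ w.1.1 :=
          (three _ v.1.2 v.2).trans (three _ w.1.2 w.2).symm
        have : Γ₂.Adj v w ↔ v.1.1 ≠ w.1.1 ∧ κ v.1.1 = κ w.1.1 := h _ _
        rw [this]
        simp [hvw, Subtype.ext_iff] }
  obtain ⟨e₁⟩ := SimpleGraph.nonempty_iso_completeGraph_sum (Γ := Γ₁) (fun v => κ v.1 = 1) hb'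
    (by
      intro v w hv
      have : Γ₁.Adj v w ↔ v.1 ≠ w.1 ∧ κ v.1 = κ w.1 := h _ _
      rw [this, hv, eq_comm (a := (1 : Fin 3)), Ne, Ne, Subtype.ext_iff]) e₂
  exact SimpleGraph.nonempty_iso_completeGraph_sum (fun v => κ v = 0) ha
    (by
      intro v w hv
      rw [h, hv, eq_comm (a := (0 : Fin 3))]) e₁

/-- Removing an empty summand. -/
def SimpleGraph.Iso.sumEmpty {V W : Type*} [IsEmpty W] (Γ : SimpleGraph V) (Δ : SimpleGraph W) :
    Γ ⊕g Δ ≃g Γ where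
  toEquiv := Equiv.sumEmpty V W
  map_rel_iff' := by
    rintro (v | v) (w | w)
    · simp
    · exact isEmptyElim w
    · exact isEmptyElim v
    · exact isEmptyElim v

end Graph

/-! ### Adjacency of conjugacy classes, and class counting -/

namespace CCCVertex

open DihedralGroup

variable {G : Type*} [Group G] {n : ℕ} (φ : G →* DihedralGroup n)

/-- The kind of the image of a conjugacy class in a dihedral group. -/
noncomputable def kind (v : CCCVertex G) : Fin 3 :=
  DihedralGroup.kind (φ v.2.choose)

theorem kind_eq (v : CCCVertex G) {x : G} (hx : x ∈ v.1.carrier) :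
    v.kind φ = DihedralGroup.kind (φ x) := by
  rw [ConjClasses.mem_carrier_iff_mk_eq] at hx
  have h : IsConj v.2.choose x := by
    rw [← ConjClasses.mk_eq_mk_iff_isConj, hx, v.2.choose_spec.2]
  exact kind_eq_of_isConj (φ.map_isConj h)

variable {φ}

theorem notMem_center (v : CCCVertex G) {x : G} (hx : x ∈ v.1.carrier) :
    x ∉ Subgroup.center G := by
  obtain ⟨y, hy, hyv⟩ := v.2
  rw [ConjClasses.mem_carrier_iff_mk_eq, ← hyv, ConjClasses.mk_eq_mk_iff_isConj] at hx
  obtain ⟨c, hc⟩ := isConj_iff.1 hx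
  intro h
  apply hy
  rw [← hc]
  exact (inferInstance : (Subgroup.center G).Normal).conj_mem x h c

theorem exists_mem_carrier (v : CCCVertex G) : ∃ x, x ∈ v.1.carrier := by
  obtain ⟨x, -, hx⟩ := v.2
  exact ⟨x, ConjClasses.mem_carrier_iff_mk_eq.2 hx⟩

/-- Commuting elements have images that are both rotations or equal, hence of one kind. Conversely,
any two representatives over rotations commute; over reflections of equal kind the images are
conjugate, and conjugating `x` by a lift of the conjugator gives it the same image as `y`. -/
theorem cccGraph_adj_iff [NeZero n] (hφ : Function.Surjective φ)
    (hker : ∀ g, φ g = 1 ↔ g ∈ Subgroup.center G) (v w : CCCVertex G) :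
    (cccGraph G).Adj v w ↔ v ≠ w ∧ v.kind φ = w.kind φ := by
  have hne : ∀ (v : CCCVertex G) {x : G}, x ∈ v.1.carrier → φ x ≠ 1 := fun v x hx h =>
    v.notMem_center hx ((hker x).1 h)
  refine and_congr_right fun _ => ⟨?_, fun h => ?_⟩
  · rintro ⟨x, hx, y, hy, hxy⟩
    rw [kind_eq φ v hx, kind_eq φ w hy]
    rcases (commute_iff_of_map_ne_one hφ hker (hne v hx) (hne w hy)).1 hxy with ⟨h1, h2⟩ | h
    · rw [h1, h2]
    · rw [h]
  · obtain ⟨x, hx⟩ := v.exists_mem_carrier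
    obtain ⟨y, hy⟩ := w.exists_mem_carrier
    rw [kind_eq φ v hx, kind_eq φ w hy] at h
    by_cases h0 : DihedralGroup.kind (φ x) = 0
    · exact ⟨x, hx, y, hy, commute_of_kind_eq_zero hφ hker h0 (h ▸ h0)⟩
    · obtain ⟨c, hc⟩ := isConj_iff.1 (isConj_of_kind_eq h0 h)
      obtain ⟨g, rfl⟩ := hφ c
      have hgx : g * x * g⁻¹ ∈ v.1.carrier := by
        rw [ConjClasses.mem_carrier_iff_mk_eq] at hx ⊢
        rw [← hx, ConjClasses.mk_eq_mk_iff_isConj, isConj_comm]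
        exact isConj_iff.2 ⟨g, rfl⟩
      refine ⟨g * x * g⁻¹, hgx, y, hy, ?_⟩
      rw [commute_iff_of_map_ne_one hφ hker (hne v hgx) (hne w hy)]
      right
      simpa using hc

variable [Finite G]

/-- The non-central elements of a given kind are the disjoint union of their conjugacy classes, all
of size `s`. -/
theorem card_kind_mul (hker : ∀ g, φ g = 1 ↔ g ∈ Subgroup.center G) (k : Fin 3) (s : ℕ)
    (hs : ∀ x, φ x ≠ 1 → DihedralGroup.kind (φ x) = k → (ConjClasses.mk x).carrier.ncard = s) :
    Nat.card {v : CCCVertex G // v.kind φ = k} * s =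
      Nat.card {g : G // φ g ≠ 1 ∧ DihedralGroup.kind (φ g) = k} := by
  classical
  have := Fintype.ofFinite G
  let e : (Σ v : {v : CCCVertex G // v.kind φ = k}, v.1.1.carrier) ≃
      {g : G // φ g ≠ 1 ∧ DihedralGroup.kind (φ g) = k} :=
    { toFun := fun p => ⟨p.2.1, fun h => p.1.1.notMem_center p.2.2 ((hker _).1 h),
        (kind_eq φ p.1.1 p.2.2).symm.trans p.1.2⟩
      invFun := fun g =>
        ⟨⟨⟨ConjClasses.mk g.1, g.1, fun h => g.2.1 ((hker _).2 h), rfl⟩,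
          (kind_eq φ _ ConjClasses.mem_carrier_mk).trans g.2.2⟩, g.1,
          ConjClasses.mem_carrier_mk⟩
      left_inv := by
        rintro ⟨⟨⟨c, hc⟩, hk⟩, x, hx⟩
        obtain rfl := ConjClasses.mem_carrier_iff_mk_eq.1 hx
        rfl
      right_inv := fun g => rfl }
  rw [← Nat.card_congr e, Nat.card_sigma, Finset.sum_congr rfl (g := fun _ => s)]
  · simp
  · rintro ⟨v, hv⟩ -
    obtain ⟨x, hx⟩ := v.exists_mem_carrier
    have h1 := ConjClasses.mem_carrier_iff_mk_eq.1 hx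
    rw [Nat.card_coe_set_eq, ← h1]
    exact hs x (fun h => v.notMem_center hx ((hker x).1 h)) (by rw [← kind_eq φ v hx, hv])

end CCCVertex

/-! ### Numbers of elements and of classes of each kind -/

section Counting

open DihedralGroup

variable {G : Type*} [Group G] {n : ℕ} [NeZero n] {φ : G →* DihedralGroup n}

/-- Right multiplication by a lift of `r 1` raises the index of a reflection by one, which flips its
parity when n is even. -/
theorem card_kind_one_eq_two (hφ : Function.Surjective φ) (hn : Even n) :
    Nat.card {g : G // φ g ≠ 1 ∧ kind (φ g) = 1} =
      Nat.card {g : G // φ g ≠ 1 ∧ kind (φ g) = 2} := by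
  obtain ⟨a, ha⟩ := hφ (r 1)
  refine Nat.card_congr ((Equiv.mulRight a).subtypeEquiv fun g => ?_)
  have h1 : ∀ d : DihedralGroup n, kind d ≠ 0 → d ≠ 1 := by
    rintro d h rfl
    exact h (by rw [one_def, kind_r])
  have h2 : ∀ d : DihedralGroup n, ∀ k : Fin 3, k ≠ 0 → ((d ≠ 1 ∧ kind d = k) ↔ kind d = k) :=
    fun d k hk => ⟨fun h => h.2, fun h => ⟨h1 d (h ▸ hk), h⟩⟩
  rw [h2 _ _ (by decide), h2 _ _ (by decide), Equiv.coe_mulRight, map_mul, ha,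
    kind_mul_r_one_eq_two_iff hn]

variable [Finite G]

theorem card_kind_eq_zero (hφ : Function.Surjective φ)
    (hker : ∀ g, φ g = 1 ↔ g ∈ Subgroup.center G) :
    Nat.card {g : G // kind (φ g) = 0} = n * Nat.card (Subgroup.center G) ∧
      Nat.card {g : G // kind (φ g) ≠ 0} = n * Nat.card (Subgroup.center G) := by
  classical
  have := Fintype.ofFinite G
  have hk : φ.ker = Subgroup.center G := by
    ext g
    rw [MonoidHom.mem_ker, hker]
  have hG : Nat.card G = 2 * n * Nat.card (Subgroup.center G) := by
    rw [← hk, ← φ.ker.index_mul_card, Subgroup.index_ker, MonoidHom.range_eq_top.2 hφ,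
      Subgroup.card_top, nat_card]
  have hA : Nat.card {g : G // kind (φ g) = 0} * 2 = Nat.card G := by
    have h := ((Subgroup.zpowers (r 1 : DihedralGroup n)).comap φ).card_mul_index
    rw [Subgroup.index_comap_of_surjective _ hφ, index_zpowers_r_one] at h
    rw [← h]
    congr 1
    exact Nat.card_congr (Equiv.subtypeEquivRight fun g => mem_zpowers_r_one_iff.symm)
  have hs : Nat.card {g : G // kind (φ g) = 0} + Nat.card {g : G // kind (φ g) ≠ 0} =
      Nat.card G := by
    rw [← Nat.card_sum]
    exact Nat.card_congr (Equiv.sumCompl _)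
  rw [hG, mul_assoc] at hA hs
  omega

theorem card_noncentral_kind_eq_zero (hφ : Function.Surjective φ)
    (hker : ∀ g, φ g = 1 ↔ g ∈ Subgroup.center G) :
    Nat.card {g : G // φ g ≠ 1 ∧ kind (φ g) = 0} = (n - 1) * Nat.card (Subgroup.center G) := by
  have h1 : {g : G | φ g ≠ 1 ∧ kind (φ g) = 0} =
      {g : G | kind (φ g) = 0} \ (Subgroup.center G : Set G) := by
    ext g
    simp [← hker, and_comm]
  have h2 : (Subgroup.center G : Set G) ⊆ {g : G | kind (φ g) = 0} := by
    intro g hg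
    have : φ g = r 0 := (hker g).2 hg
    change kind (φ g) = 0
    rw [this, kind_r]
  have h3 := Set.ncard_sdiff h2
  have h4 := (card_kind_eq_zero hφ hker).1
  rw [← Set.coe_ofPred, Nat.card_coe_set_eq] at h4 ⊢
  rw [h1, h3, h4, Nat.sub_mul, one_mul, ← Nat.card_coe_set_eq]
  rfl

theorem card_kind_one_add_two (hφ : Function.Surjective φ)
    (hker : ∀ g, φ g = 1 ↔ g ∈ Subgroup.center G) :
    Nat.card {g : G // φ g ≠ 1 ∧ kind (φ g) = 1} + Nat.card {g : G // φ g ≠ 1 ∧ kind (φ g) = 2} =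
      n * Nat.card (Subgroup.center G) := by
  rw [← (card_kind_eq_zero hφ hker).2, ← Set.coe_ofPred, ← Set.coe_ofPred, ← Set.coe_ofPred,
    Nat.card_coe_set_eq, Nat.card_coe_set_eq, Nat.card_coe_set_eq, ← Set.ncard_union_eq]
  · congr 1
    ext g
    have three : ∀ i : Fin 3, i ≠ 0 ↔ i = 1 ∨ i = 2 := by decide
    have h1 : kind (φ g) ≠ 0 → φ g ≠ 1 := by
      rintro h h'
      exact h (by rw [h', one_def, kind_r])
    simp only [Set.mem_union, Set.mem_ofPred_eq, ← and_or_left, ← three]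
    exact ⟨fun h => h.2, fun h => ⟨h1 h, h⟩⟩
  · rw [Set.disjoint_left]
    rintro g ⟨-, h1⟩ ⟨-, h2⟩
    rw [h1] at h2
    exact absurd h2 (by decide)

theorem card_kind_zero_mul_two (hφ : Function.Surjective φ)
    (hker : ∀ g, φ g = 1 ↔ g ∈ Subgroup.center G) :
    Nat.card {v : CCCVertex G // v.kind φ = 0} * 2 = (n - 1) * Nat.card (Subgroup.center G) := by
  rw [CCCVertex.card_kind_mul hker 0 2, card_noncentral_kind_eq_zero hφ hker]
  exact fun x hx h => ncard_carrier_mk_of_kind_eq_zero hφ hker hx h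

/-- The nz elements over reflections fall into classes of n elements each. -/
theorem card_vertex_kind_one_add_two (hφ : Function.Surjective φ)
    (hker : ∀ g, φ g = 1 ↔ g ∈ Subgroup.center G) :
    Nat.card {v : CCCVertex G // v.kind φ = 1} + Nat.card {v : CCCVertex G // v.kind φ = 2} =
      Nat.card (Subgroup.center G) := by
  apply Nat.eq_of_mul_eq_mul_right (NeZero.pos n)
  rw [add_mul, CCCVertex.card_kind_mul hker 1 n, CCCVertex.card_kind_mul hker 2 n,
    card_kind_one_add_two hφ hker, mul_comm]
  · exact fun x _ h => ncard_carrier_mk_of_kind_ne_zero hφ hker (by simp [h])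
  · exact fun x _ h => ncard_carrier_mk_of_kind_ne_zero hφ hker (by simp [h])

theorem card_vertex_kind_one_eq_two (hφ : Function.Surjective φ)
    (hker : ∀ g, φ g = 1 ↔ g ∈ Subgroup.center G) (hn : Even n) :
    Nat.card {v : CCCVertex G // v.kind φ = 1} = Nat.card {v : CCCVertex G // v.kind φ = 2} := by
  apply Nat.eq_of_mul_eq_mul_right (NeZero.pos n)
  rw [CCCVertex.card_kind_mul hker 1 n, CCCVertex.card_kind_mul hker 2 n,
    card_kind_one_eq_two hφ hn]
  · exact fun x _ h => ncard_carrier_mk_of_kind_ne_zero hφ hker (by simp [h])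
  · exact fun x _ h => ncard_carrier_mk_of_kind_ne_zero hφ hker (by simp [h])

end Counting

/-! ### Structure of the commuting conjugacy class graph -/

section Structure

variable {G : Type*} [Group G] {n : ℕ}

theorem exists_surjective_of_quotient_center
    (hG : Nonempty (G ⧸ Subgroup.center G ≃* DihedralGroup n)) :
    ∃ φ : G →* DihedralGroup n, Function.Surjective φ ∧
      ∀ g, φ g = 1 ↔ g ∈ Subgroup.center G := by
  obtain ⟨e⟩ := hG
  refine ⟨e.toMonoidHom.comp (QuotientGroup.mk' _),
    e.surjective.comp (QuotientGroup.mk'_surjective _), fun g => ?_⟩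
  simp

variable [Finite G]

theorem cccGraph_iso_of_even [NeZero n] (hn : Even n)
    (hG : Nonempty (G ⧸ Subgroup.center G ≃* DihedralGroup n)) {z : ℕ}
    (hz : Nat.card (Subgroup.center G) = z) :
    Even z ∧ Nonempty (cccGraph G ≃g
      (SimpleGraph.completeGraph (Fin ((n - 1) * z / 2)) ⊕g
        (SimpleGraph.completeGraph (Fin (z / 2)) ⊕g
          SimpleGraph.completeGraph (Fin (z / 2))))) := by
  obtain ⟨φ, hφ, hker⟩ := exists_surjective_of_quotient_center hG
  have h0 := card_kind_zero_mul_two hφ hker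
  have h1 := card_vertex_kind_one_add_two hφ hker
  have h2 := card_vertex_kind_one_eq_two hφ hker hn
  rw [hz] at h0 h1
  refine ⟨⟨_, by rw [← h1, h2]⟩, ?_⟩
  exact SimpleGraph.nonempty_iso_completeGraph_sum_sum (CCCVertex.kind φ)
    (CCCVertex.cccGraph_adj_iff hφ hker) (by omega) (by omega) (by omega)

theorem cccGraph_iso_of_odd (hn : Odd n)
    (hG : Nonempty (G ⧸ Subgroup.center G ≃* DihedralGroup n)) {z : ℕ}
    (hz : Nat.card (Subgroup.center G) = z) :
    Nonempty (cccGraph G ≃g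
      (SimpleGraph.completeGraph (Fin ((n - 1) * z / 2)) ⊕g
        SimpleGraph.completeGraph (Fin z))) := by
  have : NeZero n := ⟨hn.pos.ne'⟩
  obtain ⟨φ, hφ, hker⟩ := exists_surjective_of_quotient_center hG
  have h0 := card_kind_zero_mul_two hφ hker
  have h1 := card_vertex_kind_one_add_two hφ hker
  -- For odd n every index is even in `ZMod n`, so the third clique is empty and can be dropped.
  have h2 : Nat.card {v : CCCVertex G // v.kind φ = 2} = 0 := by
    have : IsEmpty {v : CCCVertex G // v.kind φ = 2} :=
      ⟨fun v => DihedralGroup.kind_ne_two_of_odd hn _ v.2⟩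
    exact Nat.card_of_isEmpty
  rw [hz] at h0 h1
  obtain ⟨e⟩ := SimpleGraph.nonempty_iso_completeGraph_sum_sum (CCCVertex.kind φ)
    (CCCVertex.cccGraph_adj_iff hφ hker) (a := (n - 1) * z / 2) (b := z) (c := 0)
    (by omega) (by omega) h2
  exact ⟨e.trans (SimpleGraph.Iso.sumCongr .refl (SimpleGraph.Iso.sumEmpty _ _))⟩

end Structure

/-! ### Signs of the deviations from the mean -/

section Arithmetic

variable {n z D : ℝ}

/-- Here `D` stands for Δ, and `hD` is the definition of the mean with the common factor z/2
cancelled. Only the middle eigenvalue lies above the mean. -/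
theorem cnl_energy_even (hn : 4 ≤ n) (hz : 2 ≤ z)
    (hD : D * (n + 1) = (n - 1) * (((n - 1) * z / 2 - 1) * ((n - 1) * z / 2 - 2)) +
      2 * ((z / 2 - 1) * (z / 2 - 2))) :
    3 * |0 - D| + (n * z - z - 2) / 2 * |1 / 4 * (n * z - z) * (n * z - z - 4) - D| +
        (z - 2) * |1 / 4 * z * (z - 4) - D| =
      ((n - 1) * z - 2) * (n * (z + 1) * ((n - 2) * z - 4) + 11 * z - 4) / (2 * (n + 1)) := by
  -- Shifting both variables to start at 0 leaves, after clearing the denominator, polynomials with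
  -- nonnegative coefficients, which `positivity` accepts. The later energy lemmas use the same
  -- device.
  obtain ⟨s, rfl⟩ : ∃ s, n = 4 + s := ⟨n - 4, by ring⟩
  obtain ⟨t, rfl⟩ : ∃ t, z = 2 + 2 * t := ⟨(z - 2) / 2, by ring⟩
  replace hn : 0 ≤ s := by linarith
  replace hz : 0 ≤ t := by linarith
  have hpos : (0 : ℝ) < 4 + s + 1 := by linarith
  rw [← eq_div_iff hpos.ne'] at hD
  have h1 : 0 ≤ D := by
    rw [hD]
    refine div_nonneg ?_ hpos.le
    ring_nf
    positivity
  have h2 : D ≤ 1 / 4 * ((4 + s) * (2 + 2 * t) - (2 + 2 * t)) *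
      ((4 + s) * (2 + 2 * t) - (2 + 2 * t) - 4) := by
    rw [hD, div_le_iff₀ hpos, ← sub_nonneg]
    ring_nf
    positivity
  have h3 : 1 / 4 * (2 + 2 * t) * (2 + 2 * t - 4) ≤ D := by
    rw [hD, le_div_iff₀ hpos, ← sub_nonneg]
    ring_nf
    positivity
  rw [abs_of_nonpos (by linarith), abs_of_nonneg (by linarith), abs_of_nonpos (by linarith), hD]
  field_simp
  ring

theorem cnsl_energy_even (hn : 4 ≤ n) (hz : 2 ≤ z) (h : 6 ≤ n ∨ 4 ≤ z)
    (hD : D * (n + 1) = (n - 1) * (((n - 1) * z / 2 - 1) * ((n - 1) * z / 2 - 2)) +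
      2 * ((z / 2 - 1) * (z / 2 - 2))) :
    |1 / 2 * (n * z - z - 2) * (n * z - z - 4) - D| +
        (n * z - z - 2) / 2 * |1 / 4 * (n * z - z - 4) ^ 2 - D| +
        2 * |1 / 2 * (z - 2) * (z - 4) - D| + (z - 2) * |1 / 4 * (z - 4) ^ 2 - D| =
      (n - 2) * (n - 1) * z ^ 2 * (n * z - 6) / (2 * (n + 1)) := by
  have hpos : (0 : ℝ) < n + 1 := by linarith
  rw [← eq_div_iff hpos.ne'] at hD
  -- This bound fails at n = 4, z = 2, where the right side is 1 and D = 6/5; hence the two ranges.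
  have h1 : D ≤ 1 / 4 * (n * z - z - 4) ^ 2 := by
    rw [hD, div_le_iff₀ hpos, ← sub_nonneg]
    rcases h with h | h
    · obtain ⟨s, rfl⟩ : ∃ s, n = 6 + s := ⟨n - 6, by ring⟩
      obtain ⟨t, rfl⟩ : ∃ t, z = 2 + 2 * t := ⟨(z - 2) / 2, by ring⟩
      replace h : 0 ≤ s := by linarith
      replace hz : 0 ≤ t := by linarith
      ring_nf
      positivity
    · obtain ⟨s, rfl⟩ : ∃ s, n = 4 + s := ⟨n - 4, by ring⟩
      obtain ⟨t, rfl⟩ : ∃ t, z = 4 + 2 * t := ⟨(z - 4) / 2, by ring⟩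
      replace hn : 0 ≤ s := by linarith
      replace h : 0 ≤ t := by linarith
      ring_nf
      positivity
  obtain ⟨s, rfl⟩ : ∃ s, n = 4 + s := ⟨n - 4, by ring⟩
  obtain ⟨t, rfl⟩ : ∃ t, z = 2 + 2 * t := ⟨(z - 2) / 2, by ring⟩
  replace hn : 0 ≤ s := by linarith
  replace hz : 0 ≤ t := by linarith
  have h2 : D ≤ 1 / 2 * ((4 + s) * (2 + 2 * t) - (2 + 2 * t) - 2) *
      ((4 + s) * (2 + 2 * t) - (2 + 2 * t) - 4) := by
    rw [hD, div_le_iff₀ hpos, ← sub_nonneg]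
    ring_nf
    positivity
  have h3 : 1 / 2 * (2 + 2 * t - 2) * (2 + 2 * t - 4) ≤ D := by
    rw [hD, le_div_iff₀ hpos, ← sub_nonneg]
    ring_nf
    positivity
  have h4 : 1 / 4 * (2 + 2 * t - 4) ^ 2 ≤ D := by
    rw [hD, le_div_iff₀ hpos, ← sub_nonneg]
    ring_nf
    positivity
  rw [abs_of_nonneg (by linarith), abs_of_nonneg (by linarith), abs_of_nonpos (by linarith),
    abs_of_nonpos (by linarith), hD]
  field_simp
  ring

/-- The case n = 3 is left out because there z(z-2) - D = z - 2, so the last sign is reversed for z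
> 2. -/
theorem cnl_energy_odd (hn : 5 ≤ n) (hz : 1 ≤ z)
    (hD : D * (n + 1) = (n - 1) * (((n - 1) * z / 2 - 1) * ((n - 1) * z / 2 - 2)) +
      2 * ((z - 1) * (z - 2))) :
    2 * |0 - D| + (n * z - z - 2) / 2 * |1 / 4 * (n * z - z) * (n * z - z - 4) - D| +
        (z - 1) * |z * (z - 2) - D| =
      ((n - 1) * z - 2) * ((n - 3) * (n + 1) * z ^ 2 + ((n - 6) * n + 17) * z - 4 * (n + 1)) /
        (2 * (n + 1)) := by
  obtain ⟨s, rfl⟩ : ∃ s, n = 5 + 2 * s := ⟨(n - 5) / 2, by ring⟩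
  obtain ⟨t, rfl⟩ : ∃ t, z = 1 + t := ⟨z - 1, by ring⟩
  replace hn : 0 ≤ s := by linarith
  replace hz : 0 ≤ t := by linarith
  have hpos : (0 : ℝ) < 5 + 2 * s + 1 := by linarith
  rw [← eq_div_iff hpos.ne'] at hD
  have h1 : 0 ≤ D := by
    rw [hD]
    refine div_nonneg ?_ hpos.le
    ring_nf
    positivity
  have h2 : D ≤ 1 / 4 * ((5 + 2 * s) * (1 + t) - (1 + t)) *
      ((5 + 2 * s) * (1 + t) - (1 + t) - 4) := by
    rw [hD, div_le_iff₀ hpos, ← sub_nonneg]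
    ring_nf
    positivity
  have h3 : (1 + t) * (1 + t - 2) ≤ D := by
    rw [hD, le_div_iff₀ hpos, ← sub_nonneg]
    ring_nf
    positivity
  rw [abs_of_nonpos (by linarith), abs_of_nonneg (by linarith), abs_of_nonpos (by linarith), hD]
  field_simp
  ring

theorem cnsl_energy_odd (hn : 5 ≤ n) (hz : 2 ≤ z)
    (hD : D * (n + 1) = (n - 1) * (((n - 1) * z / 2 - 1) * ((n - 1) * z / 2 - 2)) +
      2 * ((z - 1) * (z - 2))) :
    |1 / 2 * (n * z - z - 2) * (n * z - z - 4) - D| +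
        (n * z - z - 2) / 2 * |1 / 4 * (n * z - z - 4) ^ 2 - D| +
        |2 * (z - 1) * (z - 2) - D| + (z - 1) * |(z - 2) ^ 2 - D| =
      (n - 3) * (n - 1) * z ^ 2 * (n * z + z - 6) / (2 * (n + 1)) := by
  obtain ⟨s, rfl⟩ : ∃ s, n = 5 + 2 * s := ⟨(n - 5) / 2, by ring⟩
  obtain ⟨t, rfl⟩ : ∃ t, z = 2 + t := ⟨z - 2, by ring⟩
  replace hn : 0 ≤ s := by linarith
  replace hz : 0 ≤ t := by linarith
  have hpos : (0 : ℝ) < 5 + 2 * s + 1 := by linarith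
  rw [← eq_div_iff hpos.ne'] at hD
  have h1 : D ≤ 1 / 2 * ((5 + 2 * s) * (2 + t) - (2 + t) - 2) *
      ((5 + 2 * s) * (2 + t) - (2 + t) - 4) := by
    rw [hD, div_le_iff₀ hpos, ← sub_nonneg]
    ring_nf
    positivity
  have h2 : D ≤ 1 / 4 * ((5 + 2 * s) * (2 + t) - (2 + t) - 4) ^ 2 := by
    rw [hD, div_le_iff₀ hpos, ← sub_nonneg]
    ring_nf
    positivity
  have h3 : 2 * (2 + t - 1) * (2 + t - 2) ≤ D := by
    rw [hD, le_div_iff₀ hpos, ← sub_nonneg]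
    ring_nf
    positivity
  have h4 : (2 + t - 2) ^ 2 ≤ D := by
    rw [hD, le_div_iff₀ hpos, ← sub_nonneg]
    ring_nf
    positivity
  rw [abs_of_nonneg (by linarith), abs_of_nonneg (by linarith), abs_of_nonpos (by linarith),
    abs_of_nonpos (by linarith), hD]
  field_simp
  ring

/-- The case z = 1 of the signless energy: now (n-5)²/4 lies at or below the mean, opposite to its
position for z ≥ 2. -/
theorem cnsl_energy_odd_one (hn : 5 ≤ n)
    (hD : D * (n + 1) = (n - 1) * (((n - 1) / 2 - 1) * ((n - 1) / 2 - 2))) :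
    |1 / 2 * (n - 3) * (n - 5) - D| + (n - 3) / 2 * |1 / 4 * (n - 5) ^ 2 - D| + |D| =
      (n - 5) * (n - 3) * (n + 3) / (2 * (n + 1)) := by
  obtain ⟨s, rfl⟩ : ∃ s, n = 5 + 2 * s := ⟨(n - 5) / 2, by ring⟩
  replace hn : 0 ≤ s := by linarith
  have hpos : (0 : ℝ) < 5 + 2 * s + 1 := by linarith
  rw [← eq_div_iff hpos.ne'] at hD
  have h1 : D ≤ 1 / 2 * (5 + 2 * s - 3) * (5 + 2 * s - 5) := by
    rw [hD, div_le_iff₀ hpos, ← sub_nonneg]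
    ring_nf
    positivity
  have h2 : 1 / 4 * (5 + 2 * s - 5) ^ 2 ≤ D := by
    rw [hD, le_div_iff₀ hpos, ← sub_nonneg]
    ring_nf
    positivity
  have h3 : 0 ≤ D := le_trans (by positivity) h2
  rw [abs_of_nonneg (by linarith), abs_of_nonpos (by linarith), abs_of_nonneg h3, hD]
  field_simp
  ring

end Arithmetic

/-! ### The mean Δ of a union of cliques -/

section Spectra

variable {V : Type*} [Fintype V] [DecidableEq V] {Γ : SimpleGraph V}

theorem cnDelta_mul_card (a b : ℕ)
    (e : Γ ≃g SimpleGraph.completeGraph (Fin a) ⊕g SimpleGraph.completeGraph (Fin b))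
    (ha : 1 ≤ a) :
    cnDelta Γ * ((a : ℝ) + b) = a * ((a - 1) * (a - 2)) + b * ((b - 1) * (b - 2)) := by
  have h : (a : ℝ) + b ≠ 0 := by positivity
  rw [cnDelta_congr e, cnDelta, trace_cnRowSumMatrix_sum, trace_cnRowSumMatrix_completeGraph,
    trace_cnRowSumMatrix_completeGraph]
  simp only [Fintype.card_sum, Fintype.card_fin, Nat.cast_add]
  exact div_mul_cancel₀ _ h

theorem cnDelta_mul_card_three (a b c : ℕ)
    (e : Γ ≃g SimpleGraph.completeGraph (Fin a) ⊕g
      (SimpleGraph.completeGraph (Fin b) ⊕g SimpleGraph.completeGraph (Fin c)))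
    (ha : 1 ≤ a) :
    cnDelta Γ * ((a : ℝ) + (b + c)) =
      a * ((a - 1) * (a - 2)) + (b * ((b - 1) * (b - 2)) + c * ((c - 1) * (c - 2))) := by
  have h : (a : ℝ) + (b + c) ≠ 0 := by positivity
  rw [cnDelta_congr e, cnDelta, trace_cnRowSumMatrix_sum, trace_cnRowSumMatrix_sum,
    trace_cnRowSumMatrix_completeGraph, trace_cnRowSumMatrix_completeGraph,
    trace_cnRowSumMatrix_completeGraph]
  simp only [Fintype.card_sum, Fintype.card_fin, Nat.cast_add]
  exact div_mul_cancel₀ _ h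

end Spectra

/-! ### Spectra and energies in terms of n and z -/

section UnionSpectra

variable {V : Type*} [Fintype V] [DecidableEq V] {Γ : SimpleGraph V} {n z : ℕ}

/-- Since (n-1)z is even and at least 2, no truncated subtraction or halving loses anything, and the
natural multiplicities agree with the real expressions. -/
theorem half_vertex_count (hn : 3 ≤ n) (hz : 1 ≤ z) (h : Even ((n - 1) * z)) :
    1 ≤ (n - 1) * z / 2 ∧ (n - 1) * z / 2 - 1 = (n * z - z - 2) / 2 ∧
      (((n - 1) * z / 2 : ℕ) : ℝ) = ((n : ℝ) - 1) * z / 2 ∧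
      (((n * z - z - 2) / 2 : ℕ) : ℝ) = ((n : ℝ) * z - z - 2) / 2 := by
  obtain ⟨m, hm⟩ := h
  have h1 : n * z - z = m + m := by rw [← hm, Nat.sub_mul, one_mul]
  have h2 : 2 ≤ m + m := by
    rw [← hm]
    exact le_trans (by omega) (Nat.mul_le_mul (show 2 ≤ n - 1 by omega) hz)
  have h3 : (((n - 1) * z : ℕ) : ℝ) = m + m := by rw [hm, Nat.cast_add]
  rw [Nat.cast_mul, Nat.cast_sub (by omega), Nat.cast_one] at h3
  have h4 : (m + m) / 2 = m := by omega
  have h5 : (m + m - 2) / 2 = m - 1 := by omega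
  rw [hm, h1, h4, h5]
  refine ⟨by omega, rfl, by rw [h3]; ring, ?_⟩
  rw [Nat.cast_sub (by omega), Nat.cast_one]
  linear_combination -h3 / 2

theorem cnlSpec_of_iso_even (hn : 3 ≤ n) (hz : 1 ≤ z) (hev : Even z)
    (e : Γ ≃g SimpleGraph.completeGraph (Fin ((n - 1) * z / 2)) ⊕g
      (SimpleGraph.completeGraph (Fin (z / 2)) ⊕g SimpleGraph.completeGraph (Fin (z / 2)))) :
    cnlSpec Γ = Multiset.replicate 3 0
      + Multiset.replicate ((n * z - z - 2) / 2)
          (1 / 4 * ((n : ℝ) * z - z) * ((n : ℝ) * z - z - 4))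
      + Multiset.replicate (z - 2) (1 / 4 * (z : ℝ) * ((z : ℝ) - 4)) := by
  obtain ⟨h1, h2, h3, -⟩ := half_vertex_count hn hz (hev.mul_left _)
  obtain ⟨k, rfl⟩ := hev
  have hk : (k + k) / 2 = k := by omega
  have hk' : k + k - 2 = (k - 1) + (k - 1) := by omega
  have hx : (((n - 1) * (k + k) / 2 : ℕ) : ℝ) * (((n - 1) * (k + k) / 2 : ℕ) - 2) =
      1 / 4 * ((n : ℝ) * (k + k : ℕ) - (k + k : ℕ)) * ((n : ℝ) * (k + k : ℕ) - (k + k : ℕ) - 4) := by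
    rw [h3]
    ring
  have hy : (k : ℝ) * (k - 2) = 1 / 4 * ((k + k : ℕ) : ℝ) * (((k + k : ℕ) : ℝ) - 4) := by
    push_cast
    ring
  rw [cnlSpec_congr e, cnlSpec_sum, cnlSpec_sum, cnlSpec_completeGraph h1, hk,
    cnlSpec_completeGraph (by omega), h2, hx, hy, hk', Multiset.replicate_add (k - 1),
    Multiset.replicate_add 2 1, Multiset.replicate_add 1 1]
  abel

theorem cnslSpec_of_iso_even (hn : 3 ≤ n) (hz : 1 ≤ z) (hev : Even z)
    (e : Γ ≃g SimpleGraph.completeGraph (Fin ((n - 1) * z / 2)) ⊕g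
      (SimpleGraph.completeGraph (Fin (z / 2)) ⊕g SimpleGraph.completeGraph (Fin (z / 2)))) :
    cnslSpec Γ =
      Multiset.replicate 1 (1 / 2 * ((n : ℝ) * z - z - 2) * ((n : ℝ) * z - z - 4))
      + Multiset.replicate ((n * z - z - 2) / 2) (1 / 4 * ((n : ℝ) * z - z - 4) ^ 2)
      + Multiset.replicate 2 (1 / 2 * ((z : ℝ) - 2) * ((z : ℝ) - 4))
      + Multiset.replicate (z - 2) (1 / 4 * ((z : ℝ) - 4) ^ 2) := by
  obtain ⟨h1, h2, h3, -⟩ := half_vertex_count hn hz (hev.mul_left _)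
  obtain ⟨k, rfl⟩ := hev
  have hk : (k + k) / 2 = k := by omega
  have hk' : k + k - 2 = (k - 1) + (k - 1) := by omega
  have hx : 2 * ((((n - 1) * (k + k) / 2 : ℕ) : ℝ) - 1) * (((n - 1) * (k + k) / 2 : ℕ) - 2) =
      1 / 2 * ((n : ℝ) * (k + k : ℕ) - (k + k : ℕ) - 2) *
        ((n : ℝ) * (k + k : ℕ) - (k + k : ℕ) - 4) := by
    rw [h3]
    ring
  have hx' : ((((n - 1) * (k + k) / 2 : ℕ) : ℝ) - 2) ^ 2 =
      1 / 4 * ((n : ℝ) * (k + k : ℕ) - (k + k : ℕ) - 4) ^ 2 := by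
    rw [h3]
    ring
  have hy : 2 * ((k : ℝ) - 1) * (k - 2) =
      1 / 2 * (((k + k : ℕ) : ℝ) - 2) * (((k + k : ℕ) : ℝ) - 4) := by
    push_cast
    ring
  have hy' : ((k : ℝ) - 2) ^ 2 = 1 / 4 * (((k + k : ℕ) : ℝ) - 4) ^ 2 := by
    push_cast
    ring
  rw [cnslSpec_congr e, cnslSpec_sum, cnslSpec_sum, cnslSpec_completeGraph h1, hk,
    cnslSpec_completeGraph (by omega), h2, hx, hx', hy, hy', hk', Multiset.replicate_add (k - 1),
    Multiset.replicate_add 1 1]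
  abel

theorem cnDelta_of_iso_even (hn : 3 ≤ n) (hz : 1 ≤ z) (hev : Even z)
    (e : Γ ≃g SimpleGraph.completeGraph (Fin ((n - 1) * z / 2)) ⊕g
      (SimpleGraph.completeGraph (Fin (z / 2)) ⊕g SimpleGraph.completeGraph (Fin (z / 2)))) :
    cnDelta Γ * ((n : ℝ) + 1) =
      ((n : ℝ) - 1) * ((((n : ℝ) - 1) * z / 2 - 1) * (((n : ℝ) - 1) * z / 2 - 2)) +
        2 * (((z : ℝ) / 2 - 1) * ((z : ℝ) / 2 - 2)) := by
  obtain ⟨h1, -, h3, -⟩ := half_vertex_count hn hz (hev.mul_left _)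
  have h := cnDelta_mul_card_three _ _ _ e h1
  have hz2 : ((z / 2 : ℕ) : ℝ) = (z : ℝ) / 2 := by
    rw [Nat.cast_div hev.two_dvd (by norm_num), Nat.cast_ofNat]
  have hz0 : (z : ℝ) ≠ 0 := by positivity
  rw [h3, hz2] at h
  apply mul_right_cancel₀ hz0
  -- The vertex count is (n+1)z/2; doubling clears the half, and the factor z has just been
  -- cancelled.
  linear_combination 2 * h

theorem cnlSpec_of_iso_odd (hn : 3 ≤ n) (hz : 1 ≤ z) (hodd : Odd n)
    (e : Γ ≃g SimpleGraph.completeGraph (Fin ((n - 1) * z / 2)) ⊕g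
      SimpleGraph.completeGraph (Fin z)) :
    cnlSpec Γ = Multiset.replicate 2 0
      + Multiset.replicate ((n * z - z - 2) / 2)
          (1 / 4 * ((n : ℝ) * z - z) * ((n : ℝ) * z - z - 4))
      + Multiset.replicate (z - 1) ((z : ℝ) * ((z : ℝ) - 2)) := by
  obtain ⟨h1, h2, h3, -⟩ := half_vertex_count hn hz ((Nat.Odd.sub_odd hodd odd_one).mul_right _)
  have hx : (((n - 1) * z / 2 : ℕ) : ℝ) * (((n - 1) * z / 2 : ℕ) - 2) =
      1 / 4 * ((n : ℝ) * z - z) * ((n : ℝ) * z - z - 4) := by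
    rw [h3]
    ring
  rw [cnlSpec_congr e, cnlSpec_sum, cnlSpec_completeGraph h1, cnlSpec_completeGraph hz, h2, hx,
    Multiset.replicate_add 1 1]
  abel

theorem cnslSpec_of_iso_odd (hn : 3 ≤ n) (hz : 1 ≤ z) (hodd : Odd n)
    (e : Γ ≃g SimpleGraph.completeGraph (Fin ((n - 1) * z / 2)) ⊕g
      SimpleGraph.completeGraph (Fin z)) :
    cnslSpec Γ =
      Multiset.replicate 1 (1 / 2 * ((n : ℝ) * z - z - 2) * ((n : ℝ) * z - z - 4))
      + Multiset.replicate ((n * z - z - 2) / 2) (1 / 4 * ((n : ℝ) * z - z - 4) ^ 2)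
      + Multiset.replicate 1 (2 * ((z : ℝ) - 1) * ((z : ℝ) - 2))
      + Multiset.replicate (z - 1) (((z : ℝ) - 2) ^ 2) := by
  obtain ⟨h1, h2, h3, -⟩ := half_vertex_count hn hz ((Nat.Odd.sub_odd hodd odd_one).mul_right _)
  have hx : 2 * ((((n - 1) * z / 2 : ℕ) : ℝ) - 1) * (((n - 1) * z / 2 : ℕ) - 2) =
      1 / 2 * ((n : ℝ) * z - z - 2) * ((n : ℝ) * z - z - 4) := by
    rw [h3]
    ring
  have hx' : ((((n - 1) * z / 2 : ℕ) : ℝ) - 2) ^ 2 = 1 / 4 * ((n : ℝ) * z - z - 4) ^ 2 := by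
    rw [h3]
    ring
  rw [cnslSpec_congr e, cnslSpec_sum, cnslSpec_completeGraph h1, cnslSpec_completeGraph hz, h2,
    hx, hx']
  abel

theorem cnDelta_of_iso_odd (hn : 3 ≤ n) (hz : 1 ≤ z) (hodd : Odd n)
    (e : Γ ≃g SimpleGraph.completeGraph (Fin ((n - 1) * z / 2)) ⊕g
      SimpleGraph.completeGraph (Fin z)) :
    cnDelta Γ * ((n : ℝ) + 1) =
      ((n : ℝ) - 1) * ((((n : ℝ) - 1) * z / 2 - 1) * (((n : ℝ) - 1) * z / 2 - 2)) +
        2 * (((z : ℝ) - 1) * ((z : ℝ) - 2)) := by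
  obtain ⟨h1, -, h3, -⟩ := half_vertex_count hn hz ((Nat.Odd.sub_odd hodd odd_one).mul_right _)
  have h := cnDelta_mul_card _ _ e h1
  have hz0 : (z : ℝ) ≠ 0 := by positivity
  rw [h3] at h
  apply mul_right_cancel₀ hz0
  linear_combination 2 * h

theorem cnlEnergy_of_iso_even (hn : 4 ≤ n) (hz : 1 ≤ z) (hev : Even z)
    (e : Γ ≃g SimpleGraph.completeGraph (Fin ((n - 1) * z / 2)) ⊕g
      (SimpleGraph.completeGraph (Fin (z / 2)) ⊕g SimpleGraph.completeGraph (Fin (z / 2)))) :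
    cnlEnergy Γ = (((n : ℝ) - 1) * z - 2) *
        ((n : ℝ) * ((z : ℝ) + 1) * (((n : ℝ) - 2) * z - 4) + 11 * z - 4)
          / (2 * ((n : ℝ) + 1)) := by
  have hz2 : 2 ≤ z := by
    obtain ⟨k, rfl⟩ := hev
    omega
  obtain ⟨-, -, -, h4⟩ := half_vertex_count (show 3 ≤ n by omega) hz (hev.mul_left _)
  rw [← cnl_energy_even (by exact_mod_cast hn) (by exact_mod_cast hz2)
    (cnDelta_of_iso_even (by omega) hz hev e), cnlEnergy,
    cnlSpec_of_iso_even (by omega) hz hev e]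
  simp only [Multiset.map_add, Multiset.map_replicate, Multiset.sum_add, Multiset.sum_replicate,
    nsmul_eq_mul, h4, Nat.cast_sub hz2, Nat.cast_ofNat]

theorem cnslEnergy_of_iso_even (hn : 4 ≤ n) (hz : 1 ≤ z) (hnev : Even n) (hev : Even z)
    (e : Γ ≃g SimpleGraph.completeGraph (Fin ((n - 1) * z / 2)) ⊕g
      (SimpleGraph.completeGraph (Fin (z / 2)) ⊕g SimpleGraph.completeGraph (Fin (z / 2)))) :
    cnslEnergy Γ =
      (if n = 4 ∧ z = 2 then 28 / 5
        else if n = 4 ∧ 3 ≤ z then 3 / 5 * (z : ℝ) ^ 2 * (4 * (z : ℝ) - 6)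
        else ((n : ℝ) - 2) * ((n : ℝ) - 1) * (z : ℝ) ^ 2 * ((n : ℝ) * z - 6)
          / (2 * ((n : ℝ) + 1))) := by
  have hz2 : 2 ≤ z := by
    obtain ⟨k, rfl⟩ := hev
    omega
  have hD := cnDelta_of_iso_even (by omega) hz hev e
  obtain ⟨-, -, -, h4⟩ := half_vertex_count (show 3 ≤ n by omega) hz (hev.mul_left _)
  rw [cnslEnergy, cnslSpec_of_iso_even (by omega) hz hev e]
  simp only [Multiset.map_add, Multiset.map_replicate, Multiset.sum_add, Multiset.sum_replicate,
    nsmul_eq_mul, h4, Nat.cast_sub hz2, Nat.cast_ofNat, Nat.cast_one, one_mul]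
  by_cases h : n = 4 ∧ z = 2
  · rw [if_pos h]
    obtain ⟨rfl, rfl⟩ := h
    -- The graph is a triangle with two isolated vertices: trace 6 over 5 vertices.
    have hD' : cnDelta Γ = 6 / 5 := by
      norm_num at hD
      linarith
    rw [hD']
    norm_num [abs_of_nonneg, abs_of_nonpos]
  · have h' : (6 : ℝ) ≤ n ∨ (4 : ℝ) ≤ z := by
      obtain ⟨j, rfl⟩ := hnev
      obtain ⟨k, rfl⟩ := hev
      have : 6 ≤ j + j ∨ 4 ≤ k + k := by omega
      exact_mod_cast this
    rw [if_neg h, cnsl_energy_even (by exact_mod_cast hn) (by exact_mod_cast hz2) h' hD]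
    -- The branch n = 4, z ≥ 3 is the general formula specialized.
    split_ifs with h1
    · rw [h1.1]
      push_cast
      ring
    · rfl

theorem cnlEnergy_of_iso_odd (hn : 3 ≤ n) (hz : 1 ≤ z) (hodd : Odd n)
    (e : Γ ≃g SimpleGraph.completeGraph (Fin ((n - 1) * z / 2)) ⊕g
      SimpleGraph.completeGraph (Fin z)) :
    cnlEnergy Γ =
      (if n = 3 ∧ z = 1 then 0
        else if n = 3 ∧ 2 ≤ z then 4 * ((z : ℝ) - 1) * ((z : ℝ) - 2)
        else (((n : ℝ) - 1) * z - 2) *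
            (((n : ℝ) - 3) * ((n : ℝ) + 1) * (z : ℝ) ^ 2
              + (((n : ℝ) - 6) * n + 17) * z - 4 * ((n : ℝ) + 1))
          / (2 * ((n : ℝ) + 1))) := by
  have hD := cnDelta_of_iso_odd hn hz hodd e
  obtain ⟨-, -, -, h4⟩ := half_vertex_count hn hz ((Nat.Odd.sub_odd hodd odd_one).mul_right _)
  rw [cnlEnergy, cnlSpec_of_iso_odd hn hz hodd e]
  simp only [Multiset.map_add, Multiset.map_replicate, Multiset.sum_add, Multiset.sum_replicate,
    nsmul_eq_mul, h4, Nat.cast_sub hz, Nat.cast_ofNat, Nat.cast_one]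
  by_cases h3 : n = 3
  · subst h3
    -- For n = 3 both cliques are K_z, so Δ is the common row sum.
    have hD' : cnDelta Γ = ((z : ℝ) - 1) * (z - 2) := by
      push_cast at hD
      linarith
    by_cases h1 : z = 1
    · subst h1
      rw [hD']
      norm_num
    · have h2 : 2 ≤ z := by omega
      have h2' : (2 : ℝ) ≤ z := by exact_mod_cast h2
      rw [if_neg (by simp [h1]), if_pos ⟨rfl, h2⟩, hD']
      push_cast
      rw [abs_of_nonpos (by nlinarith), abs_of_nonneg (by nlinarith), abs_of_nonneg (by nlinarith)]
      ring
  · have h5 : 5 ≤ n := by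
      obtain ⟨j, rfl⟩ := hodd
      omega
    rw [if_neg (by simp [h3]), if_neg (by simp [h3]),
      cnl_energy_odd (by exact_mod_cast h5) (by exact_mod_cast hz) hD]

theorem cnslEnergy_of_iso_odd (hn : 3 ≤ n) (hz : 1 ≤ z) (hodd : Odd n)
    (e : Γ ≃g SimpleGraph.completeGraph (Fin ((n - 1) * z / 2)) ⊕g
      SimpleGraph.completeGraph (Fin z)) :
    cnslEnergy Γ =
      (if (n = 3 ∧ z = 1) ∨ (n = 5 ∧ z = 1) then 0
        else if n = 3 ∧ 2 ≤ z then 4 * ((z : ℝ) - 1) * ((z : ℝ) - 2)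
        else if 7 ≤ n ∧ z = 1 then
          ((n : ℝ) - 5) * ((n : ℝ) - 3) * ((n : ℝ) + 3) / (2 * ((n : ℝ) + 1))
        else ((n : ℝ) - 3) * ((n : ℝ) - 1) * (z : ℝ) ^ 2 * ((n : ℝ) * z + z - 6)
          / (2 * ((n : ℝ) + 1))) := by
  have hD := cnDelta_of_iso_odd hn hz hodd e
  obtain ⟨-, -, -, h4⟩ := half_vertex_count hn hz ((Nat.Odd.sub_odd hodd odd_one).mul_right _)
  rw [cnslEnergy, cnslSpec_of_iso_odd hn hz hodd e]
  simp only [Multiset.map_add, Multiset.map_replicate, Multiset.sum_add, Multiset.sum_replicate,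
    nsmul_eq_mul, h4, Nat.cast_sub hz, Nat.cast_one, one_mul]
  by_cases h3 : n = 3
  · subst h3
    have hD' : cnDelta Γ = ((z : ℝ) - 1) * (z - 2) := by
      push_cast at hD
      linarith
    by_cases h1 : z = 1
    · subst h1
      rw [hD']
      norm_num
    · have h2 : 2 ≤ z := by omega
      have h2' : (2 : ℝ) ≤ z := by exact_mod_cast h2
      rw [if_neg (by simp [h1]), if_pos ⟨rfl, h2⟩, hD']
      push_cast
      rw [abs_of_nonneg (by nlinarith), abs_of_nonpos (by nlinarith), abs_of_nonneg (by nlinarith),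
        abs_of_nonpos (by nlinarith)]
      ring
  · have h5 : 5 ≤ n := by
      obtain ⟨j, rfl⟩ := hodd
      omega
    have h5' : (5 : ℝ) ≤ n := by exact_mod_cast h5
    by_cases h1 : z = 1
    · subst h1
      -- With z = 1 the second clique is one vertex: it contributes |0 - Δ|, and the last
      -- multiplicity z - 1 vanishes.
      have key := cnsl_energy_odd_one h5' (D := cnDelta Γ) (by
        push_cast at hD
        linear_combination hD)
      have hl : |1 / 2 * ((n : ℝ) * (1 : ℕ) - (1 : ℕ) - 2) * ((n : ℝ) * (1 : ℕ) - (1 : ℕ) - 4) -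
            cnDelta Γ| +
          ((n : ℝ) * (1 : ℕ) - (1 : ℕ) - 2) / 2 *
            |1 / 4 * ((n : ℝ) * (1 : ℕ) - (1 : ℕ) - 4) ^ 2 - cnDelta Γ| +
          |2 * (((1 : ℕ) : ℝ) - 1) * (((1 : ℕ) : ℝ) - 2) - cnDelta Γ| +
          (((1 : ℕ) : ℝ) - 1) * |(((1 : ℕ) : ℝ) - 2) ^ 2 - cnDelta Γ| =
          |1 / 2 * ((n : ℝ) - 3) * (n - 5) - cnDelta Γ| +
            ((n : ℝ) - 3) / 2 * |1 / 4 * ((n : ℝ) - 5) ^ 2 - cnDelta Γ| + |cnDelta Γ| := by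
        rw [← abs_neg (cnDelta Γ)]
        push_cast
        ring_nf
      simp only [Nat.cast_one] at hl key ⊢
      rw [hl, key]
      -- The factor n - 5 in the formula for z = 1 gives the value 0 here.
      by_cases h : n = 5
      · subst h
        norm_num
      · have h7 : 7 ≤ n := by
          obtain ⟨j, rfl⟩ := hodd
          omega
        rw [if_neg (by simp [h3, h]), if_neg (by simp [h3]), if_pos (by simp [h7])]
    · have h2 : 2 ≤ z := by omega
      rw [if_neg (by simp [h1]), if_neg (by simp [h3]), if_neg (by simp [h1]),
        cnsl_energy_odd h5' (by exact_mod_cast h2) hD]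

end UnionSpectra

theorem mainTheorem2 (G : Type*) [Group G] [Finite G] (n z : ℕ) (hn : 3 ≤ n)
    (hz : Nat.card (Subgroup.center G) = z)
    (hG : Nonempty (G ⧸ Subgroup.center G ≃* DihedralGroup n)) :
    (Even n →
      -- the structure of the graph
      (Even z ∧
        Nonempty (cccGraph G ≃g
          (SimpleGraph.completeGraph (Fin ((n - 1) * z / 2)) ⊕g
            (SimpleGraph.completeGraph (Fin (z / 2)) ⊕g SimpleGraph.completeGraph (Fin (z / 2)))))) ∧
      -- the Laplacian spectrum and energy
      cnlSpec (cccGraph G) =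
        Multiset.replicate 3 0
          + Multiset.replicate ((n * z - z - 2) / 2)
              (1 / 4 * ((n : ℝ) * z - z) * ((n : ℝ) * z - z - 4))
          + Multiset.replicate (z - 2) (1 / 4 * (z : ℝ) * ((z : ℝ) - 4)) ∧
      cnlEnergy (cccGraph G) =
        (((n : ℝ) - 1) * z - 2) *
            ((n : ℝ) * ((z : ℝ) + 1) * (((n : ℝ) - 2) * z - 4) + 11 * z - 4)
          / (2 * ((n : ℝ) + 1)) ∧
      -- the signless Laplacian spectrum and energy
      cnslSpec (cccGraph G) =
        Multiset.replicate 1 (1 / 2 * ((n : ℝ) * z - z - 2) * ((n : ℝ) * z - z - 4))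
          + Multiset.replicate ((n * z - z - 2) / 2) (1 / 4 * ((n : ℝ) * z - z - 4) ^ 2)
          + Multiset.replicate 2 (1 / 2 * ((z : ℝ) - 2) * ((z : ℝ) - 4))
          + Multiset.replicate (z - 2) (1 / 4 * ((z : ℝ) - 4) ^ 2) ∧
      cnslEnergy (cccGraph G) =
        (if n = 4 ∧ z = 2 then 28 / 5
        else if n = 4 ∧ 3 ≤ z then 3 / 5 * (z : ℝ) ^ 2 * (4 * (z : ℝ) - 6)
        else ((n : ℝ) - 2) * ((n : ℝ) - 1) * (z : ℝ) ^ 2 * ((n : ℝ) * z - 6)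
          / (2 * ((n : ℝ) + 1)))) ∧
    (Odd n →
      -- the structure of the graph
      Nonempty (cccGraph G ≃g
        (SimpleGraph.completeGraph (Fin ((n - 1) * z / 2)) ⊕g SimpleGraph.completeGraph (Fin z))) ∧
      -- the Laplacian spectrum and energy
      cnlSpec (cccGraph G) =
        Multiset.replicate 2 0
          + Multiset.replicate ((n * z - z - 2) / 2)
              (1 / 4 * ((n : ℝ) * z - z) * ((n : ℝ) * z - z - 4))
          + Multiset.replicate (z - 1) ((z : ℝ) * ((z : ℝ) - 2)) ∧
      cnlEnergy (cccGraph G) =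
        (if n = 3 ∧ z = 1 then 0
        else if n = 3 ∧ 2 ≤ z then 4 * ((z : ℝ) - 1) * ((z : ℝ) - 2)
        else (((n : ℝ) - 1) * z - 2) *
            (((n : ℝ) - 3) * ((n : ℝ) + 1) * (z : ℝ) ^ 2
              + (((n : ℝ) - 6) * n + 17) * z - 4 * ((n : ℝ) + 1))
          / (2 * ((n : ℝ) + 1))) ∧
      -- the signless Laplacian spectrum and energy
      cnslSpec (cccGraph G) =
        Multiset.replicate 1 (1 / 2 * ((n : ℝ) * z - z - 2) * ((n : ℝ) * z - z - 4))
          + Multiset.replicate ((n * z - z - 2) / 2) (1 / 4 * ((n : ℝ) * z - z - 4) ^ 2)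
          + Multiset.replicate 1 (2 * ((z : ℝ) - 1) * ((z : ℝ) - 2))
          + Multiset.replicate (z - 1) (((z : ℝ) - 2) ^ 2) ∧
      cnslEnergy (cccGraph G) =
        (if (n = 3 ∧ z = 1) ∨ (n = 5 ∧ z = 1) then 0
        else if n = 3 ∧ 2 ≤ z then 4 * ((z : ℝ) - 1) * ((z : ℝ) - 2)
        else if 7 ≤ n ∧ z = 1 then
          ((n : ℝ) - 5) * ((n : ℝ) - 3) * ((n : ℝ) + 3) / (2 * ((n : ℝ) + 1))
        else ((n : ℝ) - 3) * ((n : ℝ) - 1) * (z : ℝ) ^ 2 * ((n : ℝ) * z + z - 6)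
          / (2 * ((n : ℝ) + 1)))) := by
  have hn0 : NeZero n := ⟨by omega⟩
  have hz1 : 1 ≤ z := hz ▸ Nat.card_pos
  refine ⟨fun hev => ?_, fun hodd => ?_⟩
  · have hn4 : 4 ≤ n := by
      obtain ⟨k, rfl⟩ := hev
      omega
    obtain ⟨hzev, ⟨e⟩⟩ := cccGraph_iso_of_even hev hG hz
    exact ⟨⟨hzev, ⟨e⟩⟩, cnlSpec_of_iso_even hn hz1 hzev e, cnlEnergy_of_iso_even hn4 hz1 hzev e,
      cnslSpec_of_iso_even hn hz1 hzev e, cnslEnergy_of_iso_even hn4 hz1 hev hzev e⟩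
  · obtain ⟨e⟩ := cccGraph_iso_of_odd hodd hG hz
    exact ⟨⟨e⟩, cnlSpec_of_iso_odd hn hz1 hodd e, cnlEnergy_of_iso_odd hn hz1 hodd e,
      cnslSpec_of_iso_odd hn hz1 hodd e, cnslEnergy_of_iso_odd hn hz1 hodd e⟩
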